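/- **Theorem 3.4.** *Setting.* Let $P_1,\dots,P_n$ ($n\ge 1$) be independent random variables and let $\mathcal A=\{A_1,\dots,A_m\}$ be a finite collection of (bad) events, each determined by $P_1,\dots,P_n$. For an event $B$ let $\mathrm{vbl}(B)$ be the smallest set of variables that determines it, and let $\Gamma(B)$ be the set of all $A\in\mathcal A$ with $A\ne B$ and $\mathrm{vbl}(A)\cap \mathrm{vbl}(B)\neq\emptyset$. An assignment of values to the variables is *good* if no event of $\mathcal A$ holds in it. Let $\varepsilon\in(0,1)$ and $x:\mathcal A\to(0,1-\varepsilon)$ be such that $$\Pr[A]^{1-\varepsilon}\le x(A)\prod_{B\in\Gamma(A)}(1-x(B))\qquad\text{for all }A\in\mathcal A,$$ put $\delta=\min_{A\in\mathcal A}x(A)\prod_{B\in\Gamma(A)}(1-x(B))$, and suppose that $\log(1/\delta)\le q(n)$, where $q$ is a fixed polynomial (with coefficients in $\mathbb N$). For $p>0$ let $\mathcal A_p=\{A\in\mathcal A:\Pr[A]\ge p\}$ be the *core* at threshold $p$. (1) For every polynomial $s$ there is a polynomial $r$ such that for all $p\ge 1/s(n)$ (where $s(n)>0$) the core $\mathcal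 A_p$ has at most $r(n)$ elements. (2) For every $c>0$ there are constants $C,D>0$ such that the following holds for every $p$ with $0<p\le n^{-D/\varepsilon}$ (in particular for the inverse polynomial $p=n^{-D/\varepsilon}$, when $\varepsilon$ is fixed). Suppose that the core $\mathcal A_p$ is verifiable in time $\tau$: we have a procedure that, given any assignment, finds in at most $\tau$ steps an event of $\mathcal A_p$ that holds or detects that there is none (efficient verifiability means $\tau\le\mathrm{poly}(n)$). Run the Moser–Tardos algorithm on $\mathcal A_p$ alone: draw an initial assignment, then repeatedly ask the procedure for an event of $\mathcal A_p$ that holds and draw new independent values for the variables in its $\mathrm{vbl}$; return the current assignment as soon as there is no such event, and give up when one more resampling would be needed after $\lfloor R\rfloor$ resamplings, where $$R=C\,\frac{n}{\varepsilon^2}\log\frac{n}{\varepsilon^2}.$$ This algorithm always stops after at most $R$ resamplings and at most $(R+1)(n+\tau)$ steps (a call of the procedure counts with its running time, drawing a value of one variable counts as one step), and with probability at least $1-n^{-c}$ it returns an assignment that is good for all of $\mathcal A$. The polynomial $r$ and the constants $C,D$ depend only on $q$, $s$, $c$ ($r$ not on $n$, $\varepsilon$, $p$, the variables, the events or $x$;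 $C,D$ neither on these nor on $s$). -/

import Mathlib

open MeasureTheory

noncomputable section

namespace LLL

universe u v

variable {n : ℕ} {Ω : Fin n → Type u}

/-! An assignment to the `n` variables is a point `ω : ∀ k, Ω k`; an event is a set of assignments.
The variables are independent, variable `k` with law `μ k`, so that the joint law is the product
measure `Measure.pi μ`. A finite collection of bad events is a family `A : ι → Set (∀ k, Ω k)`. -/

/-- Whether `B` holds depends only on the values of the variables in `S`. -/
def DeterminedBy (B : Set (∀ k, Ω k)) (S : Set (Fin n)) : Prop :=
  ∀ ω ω' : ∀ k, Ω k, (∀ k ∈ S, ω k = ω' k) → (ω ∈ B ↔ ω' ∈ B)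

/-- The smallest set of variables by which `B` is determined (see `isLeast_vbl`). -/
def vbl (B : Set (∀ k, Ω k)) : Set (Fin n) :=
  ⋂₀ {S | DeterminedBy B S}

theorem DeterminedBy.inter {B : Set (∀ k, Ω k)} {S T : Set (Fin n)}
    (hS : DeterminedBy B S) (hT : DeterminedBy B T) : DeterminedBy B (S ∩ T) := by
  classical
  intro ω ω' h
  let η : ∀ k, Ω k := fun k => if k ∈ S then ω k else ω' k
  have h1 : ω ∈ B ↔ η ∈ B := hS ω η (fun k hk => by simp [η, hk])
  have h2 : η ∈ B ↔ ω' ∈ B := hT η ω' (fun k hk => by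
    by_cases hkS : k ∈ S
    · simp [η, hkS, h k ⟨hkS, hk⟩]
    · simp [η, hkS])
  exact h1.trans h2

theorem isLeast_vbl (B : Set (∀ k, Ω k)) : IsLeast {S | DeterminedBy B S} (vbl B) := by
  refine ⟨?_, fun S hS => Set.sInter_subset_of_mem hS⟩
  have hfin : {S : Set (Fin n) | DeterminedBy B S}.Finite := Set.toFinite _
  have key : ∀ F : Set (Set (Fin n)), F.Finite → (∀ S ∈ F, DeterminedBy B S) →
      DeterminedBy B (⋂₀ F) := by
    intro F hF
    induction F, hF using Set.Finite.induction_on with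
    | empty =>
      intro _ ω ω' h
      have : ω = ω' := funext fun k => h k (by simp)
      rw [this]
    | insert _ _ ih =>
      intro h
      rw [Set.sInter_insert]
      exact (h _ (Set.mem_insert _ _)).inter (ih fun S hS => h S (Set.mem_insert_of_mem _ hS))
  exact key _ hfin fun S hS => hS

/-- The neighbourhood `Γ(A i)`: the other bad events that share a variable with `A i`. -/
def nbhd {ι : Type v} [Fintype ι] (A : ι → Set (∀ k, Ω k)) (i : ι) : Finset ι :=
  open Classical in Finset.univ.filter fun j => j ≠ i ∧ (vbl (A j) ∩ vbl (A i)).Nonempty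

/-- `x(A i) * ∏_{B ∈ Γ(A i)} (1 - x(B))`. -/
def lllBound {ι : Type v} [Fintype ι] (A : ι → Set (∀ k, Ω k)) (x : ι → ℝ) (i : ι) : ℝ :=
  x i * ∏ j ∈ nbhd A i, (1 - x j)

/-- `δ`, the minimum of `x(A i) * ∏_{B ∈ Γ(A i)} (1 - x(B))` over the (finitely many) bad events. -/
def delta {ι : Type v} [Fintype ι] (A : ι → Set (∀ k, Ω k)) (x : ι → ℝ) : ℝ :=
  ⨅ i, lllBound A x i

/-- The probability of an event under a random choice of the independent variables. -/
def prob [∀ k, MeasurableSpace (Ω k)] (μ : ∀ k, Measure (Ω k)) (B : Set (∀ k, Ω k)) : ℝ :=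
  (Measure.pi μ).real B

/-- The local lemma condition with exponential `ε`-slack, with weights `x : ι → (0, 1 - ε)`. -/
structure ExpSlack [∀ k, MeasurableSpace (Ω k)] {ι : Type v} [Fintype ι]
    (μ : ∀ k, Measure (Ω k)) (A : ι → Set (∀ k, Ω k)) (ε : ℝ) (x : ι → ℝ) : Prop where
  pos : ∀ i, 0 < x i
  lt : ∀ i, x i < 1 - ε
  bound : ∀ i, prob μ (A i) ^ (1 - ε) ≤ lllBound A x i

/-- The core at threshold `p`: the bad events of probability at least `p`. -/
def core [∀ k, MeasurableSpace (Ω k)] {ι : Type v} [Fintype ι]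
    (μ : ∀ k, Measure (Ω k)) (A : ι → Set (∀ k, Ω k)) (p : ℝ) : Finset ι :=
  open Classical in Finset.univ.filter fun i => p ≤ prob μ (A i)

/-- A verification procedure for the events with index in `S`: given an arbitrary assignment, it
finds one of these events that holds, or detects that there is none; the event found depends
measurably on the assignment (automatic for discrete variables). `cost ω` is the number of
steps that the procedure takes on the assignment `ω`, in whatever machine model it is
implemented. -/
structure Verifier [∀ k, MeasurableSpace (Ω k)] {ι : Type v}
    (A : ι → Set (∀ k, Ω k)) (S : Finset ι) where
  find : (∀ k, Ω k) → Option ι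
  cost : (∀ k, Ω k) → ℕ
  mem_of_find : ∀ ω i, find ω = some i → i ∈ S ∧ ω ∈ A i
  notMem_of_find : ∀ ω, find ω = none → ∀ i ∈ S, ω ∉ A i
  measurable_find : ∀ i, MeasurableSet {ω | find ω = some i}

/-- Replace the values of the variables in `S` by those of the fresh sample `η`. -/
def resample (S : Set (Fin n)) (ω η : ∀ k, Ω k) : ∀ k, Ω k :=
  open Classical in fun k => if k ∈ S then η k else ω k

/-- What an execution leaves behind: the returned assignment (`none` if the execution gave up), the
number of resamplings, and the number of steps. -/
structure Outcome (Ω : Fin n → Type u) where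
  result : Option (∀ k, Ω k)
  resamplings : ℕ
  steps : ℕ

/-- The Moser-Tardos loop on the events in `S`, started in `ω` and with `K` resamplings left:
ask the verification procedure for an event in `S` that holds; if there is none, return the current
assignment; otherwise resample the variables of the event found, or give up if no resampling is
left. The samples `ξ t, ξ (t + 1), …` are fresh, and each of them is used in one resampling only.
A call of the procedure is charged its cost, and drawing a value of one variable is one step. -/
def mtLoop [∀ k, MeasurableSpace (Ω k)] {ι : Type v} {A : ι → Set (∀ k, Ω k)} {S : Finset ι}
    (V : Verifier A S) (ξ : ℕ → ∀ k, Ω k) : ℕ → ℕ → (∀ k, Ω k) → Outcome Ω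
  | 0, _, ω =>
    match V.find ω with
    | none => ⟨some ω, 0, V.cost ω⟩
    | some _ => ⟨none, 0, V.cost ω⟩
  | K + 1, t, ω =>
    match V.find ω with
    | none => ⟨some ω, 0, V.cost ω⟩
    | some i =>
      let rest := mtLoop V ξ K (t + 1) (resample (vbl (A i)) ω (ξ t))
      ⟨rest.result, rest.resamplings + 1, V.cost ω + (vbl (A i)).ncard + rest.steps⟩

/-- The Moser-Tardos algorithm on the events in `S`, stopped after at most `K` resamplings: draw an
initial assignment (`n` steps), then run the loop. -/
def moserTardos [∀ k, MeasurableSpace (Ω k)] {ι : Type v} {A : ι → Set (∀ k, Ω k)} {S : Finset ι}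
    (V : Verifier A S) (K : ℕ) (ξ : ℕ → ∀ k, Ω k) : Outcome Ω :=
  let run := mtLoop V ξ K 1 (ξ 0)
  ⟨run.result, run.resamplings, n + run.steps⟩

/-- The law of the algorithm's randomness: independent samples `ξ 0, ξ 1, …`, each of them drawn
from the joint law of the variables. -/
def sampleLaw [∀ k, MeasurableSpace (Ω k)] (μ : ∀ k, Measure (Ω k))
    [∀ k, IsProbabilityMeasure (μ k)] : Measure (ℕ → ∀ k, Ω k) :=
  Measure.infinitePi fun _ : ℕ => Measure.pi μ

/-- A good assignment: no bad event holds (in the core or outside). -/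
def Good {ι : Type v} (A : ι → Set (∀ k, Ω k)) (ω : ∀ k, Ω k) : Prop :=
  ∀ i, ω ∉ A i

/-- `C (n / ε²) log (n / ε²)`. -/
def resamplingBound (C : ℝ) (n : ℕ) (ε : ℝ) : ℝ :=
  C * ((n : ℝ) / ε ^ 2) * Real.log ((n : ℝ) / ε ^ 2)

end LLL

end

/-!
The potential-function method for the Moser–Tardos algorithm. The resamplings of a run are sorted
into layers: a resampling is put right below the deepest layer with which it shares a variable. For
each possible sequence of layers ("layering") hanging from a set of variables, consider the expected
value of a function `h` after the sequence has been run with all its events holding, with an extra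
factor `lam` per resampling. The sum of these over all layerings is a potential: resampling an event
that holds prepends it to the layerings injectively, so that the potential does not increase in
expectation, and it drops by the factor `lam` if the event shares a variable with the root. Since
the expectation of the potential factorises over the events, it is bounded as in the local lemma.

With the root at the variables of an event outside the core, this bounds the probability that the
event holds at the end, by roughly its probability to the power `ε`. With the root at single
variables and `lam = exp (ε ^ 2)`, paid for by the exponential slack, it makes the probability that
more than `K` resamplings are needed decay like `exp (-ε ^ 2 * K / n)`.
-/

open scoped ENNReal

namespace LLL

variable {n : ℕ} {Ω : Fin n → Type*} {ι : Type*}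

section Resample

variable {S T : Set (Fin n)} {k : Fin n}

theorem resample_apply_of_mem (hk : k ∈ S) (ω η : ∀ k, Ω k) : resample S ω η k = η k :=
  if_pos hk

theorem resample_apply_of_notMem (hk : k ∉ S) (ω η : ∀ k, Ω k) : resample S ω η k = ω k :=
  if_neg hk

theorem resample_empty (ω η : ∀ k, Ω k) : resample ∅ ω η = ω :=
  funext fun k => resample_apply_of_notMem (Set.notMem_empty k) ω η

theorem resample_resample (S T : Set (Fin n)) (ω η η' : ∀ k, Ω k) :
    resample T (resample S ω η) η' = resample (S ∪ T) ω (resample T η η') := by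
  funext k
  by_cases hT : k ∈ T <;> by_cases hS : k ∈ S <;> simp [resample, hT, hS]

theorem resample_resample_self (S : Set (Fin n)) (ω η η' : ∀ k, Ω k) :
    resample S (resample S ω η) η' = resample S ω η' := by
  funext k
  by_cases hS : k ∈ S <;> simp [resample, hS]

theorem determinedBy_vbl (B : Set (∀ k, Ω k)) : DeterminedBy B (vbl B) :=
  (isLeast_vbl B).1

theorem DeterminedBy.resample_mem_iff {B : Set (∀ k, Ω k)} (h : DeterminedBy B S)
    (hST : Disjoint S T) (ω η : ∀ k, Ω k) : resample T ω η ∈ B ↔ ω ∈ B :=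
  h _ _ fun _ hk => resample_apply_of_notMem (Set.disjoint_left.1 hST hk) ω η

theorem DeterminedBy.resample_mem_iff_right {B : Set (∀ k, Ω k)} (h : DeterminedBy B S)
    (ω η : ∀ k, Ω k) : resample S ω η ∈ B ↔ η ∈ B :=
  h _ _ fun _ hk => resample_apply_of_mem hk ω η

variable [∀ k, MeasurableSpace (Ω k)]

theorem measurable_resample (S : Set (Fin n)) :
    Measurable fun p : (∀ k, Ω k) × (∀ k, Ω k) => resample S p.1 p.2 := by
  refine measurable_pi_iff.2 fun k => ?_
  by_cases hk : k ∈ S <;> simp only [resample, hk, if_true, if_false] <;> fun_prop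

theorem measurable_resample_right (S : Set (Fin n)) (ω : ∀ k, Ω k) : Measurable (resample S ω) :=
  (measurable_resample S).comp measurable_prodMk_left

theorem measurePreserving_resample (μ : ∀ k, Measure (Ω k)) [∀ k, IsProbabilityMeasure (μ k)]
    (S : Set (Fin n)) :
    MeasurePreserving (fun p : (∀ k, Ω k) × (∀ k, Ω k) => resample S p.1 p.2)
      ((Measure.pi μ).prod (Measure.pi μ)) (Measure.pi μ) := by
  classical
  refine ⟨measurable_resample S, (Measure.pi_eq fun s hs => ?_).symm⟩
  have hpre : (fun p : (∀ k, Ω k) × (∀ k, Ω k) => resample S p.1 p.2) ⁻¹' Set.univ.pi s =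
      (Set.univ.pi fun k => if k ∈ S then Set.univ else s k) ×ˢ
        (Set.univ.pi fun k => if k ∈ S then s k else Set.univ) := by
    ext p
    simp only [Set.mem_preimage, Set.mem_prod, Set.mem_univ_pi, ← forall_and]
    refine forall_congr' fun k => ?_
    by_cases hk : k ∈ S <;> simp [resample, hk]
  rw [Measure.map_apply (measurable_resample S) (MeasurableSet.univ_pi hs), hpre,
    Measure.prod_prod, Measure.pi_pi, Measure.pi_pi, ← Finset.prod_mul_distrib]
  refine Finset.prod_congr rfl fun k _ => ?_
  by_cases hk : k ∈ S <;> simp [hk]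

/-- The expectation of `g` after the variables in `S` have been resampled. -/
noncomputable def refresh (μ : ∀ k, Measure (Ω k)) (S : Set (Fin n)) (g : (∀ k, Ω k) → ℝ≥0∞)
    (ω : ∀ k, Ω k) : ℝ≥0∞ :=
  ∫⁻ η, g (resample S ω η) ∂Measure.pi μ

variable {μ : ∀ k, Measure (Ω k)} {g : (∀ k, Ω k) → ℝ≥0∞} {E : Set (∀ k, Ω k)}

theorem refresh_mono {g' : (∀ k, Ω k) → ℝ≥0∞} (h : g ≤ g') (S : Set (Fin n)) :
    refresh μ S g ≤ refresh μ S g' :=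
  fun _ => lintegral_mono fun _ => h _

theorem refresh_smul (a : ℝ≥0∞) (hg : Measurable g) : refresh μ S (a • g) = a • refresh μ S g :=
  funext fun ω => lintegral_const_mul a (hg.comp (measurable_resample_right S ω))

theorem refresh_sum {β : Type*} {s : Finset β} {f : β → (∀ k, Ω k) → ℝ≥0∞}
    (hf : ∀ b ∈ s, Measurable (f b)) :
    refresh μ S (∑ b ∈ s, f b) = ∑ b ∈ s, refresh μ S (f b) := by
  funext ω
  simp only [refresh, Finset.sum_apply]
  exact lintegral_finsetSum s fun b hb => (hf b hb).comp (measurable_resample_right S ω)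

theorem refresh_tsum {β : Type*} [Countable β] {f : β → (∀ k, Ω k) → ℝ≥0∞}
    (hf : ∀ b, Measurable (f b)) (ω : ∀ k, Ω k) :
    refresh μ S (fun ω => ∑' b, f b ω) ω = ∑' b, refresh μ S (f b) ω :=
  lintegral_tsum fun b => ((hf b).comp (measurable_resample_right S ω)).aemeasurable

theorem refresh_resample (ω η : ∀ k, Ω k) :
    refresh μ S g (resample S ω η) = refresh μ S g ω := by
  simp only [refresh, resample_resample_self]

theorem refresh_indicator (hE : DeterminedBy E T) (hTS : Disjoint T S) :
    refresh μ S (E.indicator g) = E.indicator (refresh μ S g) := by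
  funext ω
  by_cases hω : ω ∈ E <;> simp [refresh, Set.indicator, hE.resample_mem_iff hTS, hω]

variable [∀ k, IsProbabilityMeasure (μ k)]

theorem refresh_one : refresh μ S 1 = 1 := by
  funext ω
  simp [refresh]

theorem refresh_empty : refresh μ ∅ g = g := by
  funext ω
  simp [refresh, resample_empty]

theorem measurable_refresh (hg : Measurable g) : Measurable (refresh μ S g) :=
  (hg.comp (measurable_resample S)).lintegral_prod_right'

theorem lintegral_refresh (hg : Measurable g) :
    ∫⁻ ω, refresh μ S g ω ∂Measure.pi μ = ∫⁻ ω, g ω ∂Measure.pi μ := by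
  rw [← (measurePreserving_resample μ S).lintegral_comp hg, lintegral_prod]
  · rfl
  · exact (hg.comp (measurable_resample S)).aemeasurable

theorem refresh_refresh (hg : Measurable g) :
    refresh μ S (refresh μ T g) = refresh μ (S ∪ T) g := by
  funext ω
  simp only [refresh, resample_resample]
  exact lintegral_refresh (hg.comp (measurable_resample_right (S ∪ T) ω))

theorem lintegral_indicator_refresh (hEm : MeasurableSet E) (hE : DeterminedBy E S)
    (hg : Measurable g) :
    ∫⁻ ω, E.indicator (refresh μ S g) ω ∂Measure.pi μ =
      Measure.pi μ E * ∫⁻ ω, g ω ∂Measure.pi μ := by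
  have hconst : refresh μ S (E.indicator (refresh μ S g)) = Measure.pi μ E • refresh μ S g := by
    funext ω
    calc refresh μ S (E.indicator (refresh μ S g)) ω
        = ∫⁻ η, E.indicator (fun _ => refresh μ S g ω) η ∂Measure.pi μ := by
          refine lintegral_congr fun η => ?_
          by_cases hη : η ∈ E <;> simp [hE.resample_mem_iff_right, refresh_resample, hη]
      _ = (Measure.pi μ E • refresh μ S g) ω := by
          rw [lintegral_indicator_const hEm, mul_comm, Pi.smul_apply, smul_eq_mul]
  rw [← lintegral_refresh (S := S) ((measurable_refresh hg).indicator hEm), hconst,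
    ← lintegral_refresh (S := S) hg, ← lintegral_const_mul _ (measurable_refresh hg)]
  rfl

end Resample

section Layers

/-- The variables on which the events with index in `I` depend. -/
def vars (A : ι → Set (∀ k, Ω k)) (I : Finset ι) : Set (Fin n) := ⋃ i ∈ I, vbl (A i)

/-- A layering rooted in `R`: nonempty layers of events with index in `S`, such that the events of
a layer have disjoint sets of variables and each of them shares a variable with the layer before
(with `R`, for the first layer). The resamplings of a run that can influence the variables in `R`
form a layering, in which the last resamplings come first. -/
def IsLayering (A : ι → Set (∀ k, Ω k)) (S : Finset ι) : Set (Fin n) → List (Finset ι) → Prop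
  | _, [] => True
  | R, I :: L => I.Nonempty ∧ I ⊆ S ∧ (I : Set ι).PairwiseDisjoint (fun i => vbl (A i)) ∧
      (∀ i ∈ I, ¬ Disjoint (vbl (A i)) R) ∧ IsLayering A S (vars A I) L

/-- The event `A f` shares a variable with one of the layers. -/
def Meets (A : ι → Set (∀ k, Ω k)) (f : ι) (L : List (Finset ι)) : Prop :=
  ∃ I ∈ L, ¬ Disjoint (vbl (A f)) (vars A I)

open Classical in
/-- Record a resampling of `A f` that precedes all those recorded in `L`: insert `f` right below the
deepest layer with which `A f` shares a variable. -/
noncomputable def insertEvent (A : ι → Set (∀ k, Ω k)) (f : ι) :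
    List (Finset ι) → List (Finset ι)
  | [] => [{f}]
  | I :: L => if Meets A f (I :: L) then I :: insertEvent A f L else insert f I :: L

variable {A : ι → Set (∀ k, Ω k)} {S : Finset ι} {R R' : Set (Fin n)} {f : ι}
  {I J : Finset ι} {L : List (Finset ι)}

theorem vbl_subset_vars {i : ι} (hi : i ∈ I) : vbl (A i) ⊆ vars A I :=
  Set.subset_biUnion_of_mem (u := fun i => vbl (A i)) (Finset.mem_coe.2 hi)

theorem vars_empty : vars A ∅ = ∅ := by simp [vars]

theorem vars_singleton : vars A {f} = vbl (A f) := by simp [vars]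

theorem vars_insert [DecidableEq ι] : vars A (insert f I) = vbl (A f) ∪ vars A I := by
  simp [vars]

theorem vars_union [DecidableEq ι] : vars A (I ∪ J) = vars A I ∪ vars A J := by
  simp [vars, Set.iUnion_or, Set.iUnion_union_distrib]

theorem disjoint_vars_right : Disjoint R (vars A I) ↔ ∀ i ∈ I, Disjoint R (vbl (A i)) := by
  simp [vars, Set.disjoint_iUnion_right]

theorem notMem_of_disjoint_vars (hf : (vbl (A f)).Nonempty)
    (h : Disjoint (vbl (A f)) (vars A I)) : f ∉ I := fun hfI =>
  hf.ne_empty (disjoint_self.1 (h.mono_right (vbl_subset_vars hfI)))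

theorem determinedBy_biInter (A : ι → Set (∀ k, Ω k)) (I : Finset ι) :
    DeterminedBy (⋂ i ∈ I, A i) (vars A I) := by
  intro ω ω' hω
  simp only [Set.mem_iInter]
  exact forall₂_congr fun i hi =>
    determinedBy_vbl (A i) ω ω' fun k hk => hω k (vbl_subset_vars hi hk)

theorem not_meets_nil : ¬ Meets A f [] := by simp [Meets]

theorem meets_cons :
    Meets A f (I :: L) ↔ ¬ Disjoint (vbl (A f)) (vars A I) ∨ Meets A f L := by simp [Meets]

theorem not_meets_cons :
    ¬ Meets A f (I :: L) ↔ Disjoint (vbl (A f)) (vars A I) ∧ ¬ Meets A f L := by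
  rw [meets_cons, not_or, not_not]

theorem meets_cons_of_mem (hf : (vbl (A f)).Nonempty) (h : f ∈ I) : Meets A f (I :: L) :=
  meets_cons.2 (Or.inl fun hd => notMem_of_disjoint_vars hf hd h)

theorem IsLayering.mono (hR : R ⊆ R') (h : IsLayering A S R L) : IsLayering A S R' L := by
  cases L with
  | nil => trivial
  | cons I L =>
    obtain ⟨hne, hS, hdisj, hmeet, hL⟩ := h
    exact ⟨hne, hS, hdisj, fun i hi hd => hmeet i hi (hd.mono_right hR), hL⟩

theorem IsLayering.empty_notMem (h : IsLayering A S R L) : ∅ ∉ L := by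
  induction L generalizing R with
  | nil => simp
  | cons I L ih => exact List.not_mem_cons_of_ne_of_not_mem h.1.ne_empty.symm (ih h.2.2.2.2)

theorem IsLayering.insertEvent (h : IsLayering A S R L) (hfS : f ∈ S)
    (hf : ¬ Disjoint (vbl (A f)) R ∨ Meets A f L) : IsLayering A S R (insertEvent A f L) := by
  classical
  induction L generalizing R with
  | nil =>
    have hR : ¬ Disjoint (vbl (A f)) R := hf.resolve_right not_meets_nil
    exact ⟨by simp, by simpa using hfS, by simp, by simpa using hR, trivial⟩
  | cons I L ih =>
    obtain ⟨hne, hS, hdisj, hmeet, hL⟩ := h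
    unfold LLL.insertEvent
    split_ifs with hm
    · exact ⟨hne, hS, hdisj, hmeet, ih hL (meets_cons.1 hm)⟩
    · have hR := hf.resolve_right hm
      refine ⟨Finset.insert_nonempty _ _, Finset.insert_subset hfS hS, ?_,
        (Finset.forall_mem_insert _ _ _).2 ⟨hR, hmeet⟩, hL.mono ?_⟩
      · rw [Finset.coe_insert]
        exact hdisj.insert fun i hi _ => disjoint_vars_right.1 (not_meets_cons.1 hm).1 i hi
      · rw [vars_insert]
        exact Set.subset_union_right

theorem meets_insertEvent (hf : (vbl (A f)).Nonempty) : Meets A f (insertEvent A f L) := by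
  classical
  induction L with
  | nil => exact meets_cons_of_mem hf (Finset.mem_singleton_self f)
  | cons I L ih =>
    unfold insertEvent
    split_ifs with hm
    · exact meets_cons.2 (Or.inr ih)
    · exact meets_cons_of_mem hf (Finset.mem_insert_self f I)

theorem insertEvent_ne_nil : insertEvent A f L ≠ [] := by
  cases L with
  | nil => simp [insertEvent]
  | cons I L => unfold insertEvent; split_ifs <;> simp

theorem insertEvent_cons_ne_singleton (hf : (vbl (A f)).Nonempty) (hI : I ≠ ∅) :
    insertEvent A f (I :: L) ≠ [{f}] := by
  classical
  unfold insertEvent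
  split_ifs with hm <;> intro he
  · exact insertEvent_ne_nil (List.cons.inj he).2
  · have hfI := notMem_of_disjoint_vars hf (not_meets_cons.1 hm).1
    rw [← Finset.erase_insert hfI, (List.cons.inj he).1, Finset.erase_singleton] at hI
    exact hI rfl

theorem injOn_insertEvent (hf : (vbl (A f)).Nonempty) :
    Set.InjOn (insertEvent A f) {L | ∅ ∉ L} := by
  classical
  intro L hL L' hL' he
  induction L generalizing L' with
  | nil =>
    cases L' with
    | nil => rfl
    | cons I' L' =>
      exact absurd he.symm (insertEvent_cons_ne_singleton hf (List.ne_of_not_mem_cons hL').symm)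
  | cons I L ih =>
    cases L' with
    | nil => exact absurd he (insertEvent_cons_ne_singleton hf (List.ne_of_not_mem_cons hL).symm)
    | cons I' L' =>
      simp only [insertEvent] at he
      split_ifs at he with hm hm' hm' <;> obtain ⟨hhead, htail⟩ := List.cons.inj he
      · rw [hhead, ih (List.not_mem_of_not_mem_cons hL) (List.not_mem_of_not_mem_cons hL') htail]
      · exact absurd (meets_cons.2 (Or.inr (htail ▸ meets_insertEvent hf))) hm'
      · exact absurd (meets_cons.2 (Or.inr (htail ▸ meets_insertEvent hf))) hm
      · rw [htail, ← Finset.erase_insert (notMem_of_disjoint_vars hf (not_meets_cons.1 hm).1),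
          hhead, Finset.erase_insert (notMem_of_disjoint_vars hf (not_meets_cons.1 hm').1)]

open Classical in
/-- The effect on the layering rooted in `R` of a resampling of `A f` that precedes all those
recorded in `L`; nothing changes if it cannot influence the variables in `R`. -/
noncomputable def pushEvent (hfS : f ∈ S) (L : {L // IsLayering A S R L}) :
    {L // IsLayering A S R L} :=
  if h : ¬ Disjoint (vbl (A f)) R ∨ Meets A f L.1 then
    ⟨insertEvent A f L.1, L.2.insertEvent hfS h⟩ else L

theorem pushEvent_injective (hf : (vbl (A f)).Nonempty) (hfS : f ∈ S) :
    Function.Injective (pushEvent (A := A) (R := R) hfS) := by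
  intro L L' he
  unfold pushEvent at he
  split_ifs at he with h h' h'
  · exact Subtype.ext (injOn_insertEvent hf L.2.empty_notMem L'.2.empty_notMem
      (congrArg Subtype.val he))
  · exact absurd (Or.inr (congrArg Subtype.val he ▸ meets_insertEvent hf)) h'
  · exact absurd (Or.inr ((congrArg Subtype.val he).symm ▸ meets_insertEvent hf)) h
  · exact he

end Layers

section Potential

variable [∀ k, MeasurableSpace (Ω k)]

/-- Expectation of `g` after the variables of the events in `I` have been resampled, where all of
these events have to hold before, with weight `lam` for each event. -/
noncomputable def layerOp (μ : ∀ k, Measure (Ω k)) (A : ι → Set (∀ k, Ω k)) (lam : ℝ≥0∞)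
    (I : Finset ι) (g : (∀ k, Ω k) → ℝ≥0∞) : (∀ k, Ω k) → ℝ≥0∞ :=
  lam ^ I.card • (⋂ i ∈ I, A i).indicator (refresh μ (vars A I) g)

/-- The layers act on `h`, the first layer of the list first. -/
noncomputable def layersOp (μ : ∀ k, Measure (Ω k)) (A : ι → Set (∀ k, Ω k)) (lam : ℝ≥0∞)
    (h : (∀ k, Ω k) → ℝ≥0∞) (L : List (Finset ι)) : (∀ k, Ω k) → ℝ≥0∞ :=
  L.foldl (fun g I => layerOp μ A lam I g) h

/-- The sum of all layerings rooted in `R`, applied to `h`. -/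
noncomputable def potential (μ : ∀ k, Measure (Ω k)) (A : ι → Set (∀ k, Ω k)) (lam : ℝ≥0∞)
    (S : Finset ι) (R : Set (Fin n)) (h : (∀ k, Ω k) → ℝ≥0∞) (ω : ∀ k, Ω k) : ℝ≥0∞ :=
  ∑' L : {L // IsLayering A S R L}, layersOp μ A lam h L.1 ω

/-- The weight of a layering: the product of the weights of all its events. -/
noncomputable def layersWeight (w : ι → ℝ≥0∞) (L : List (Finset ι)) : ℝ≥0∞ :=
  (L.map fun I => ∏ i ∈ I, w i).prod

variable {μ : ∀ k, Measure (Ω k)} {A : ι → Set (∀ k, Ω k)} {lam : ℝ≥0∞} {S : Finset ι}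
  {R : Set (Fin n)} {f : ι} {I J : Finset ι} {L : List (Finset ι)} {g h : (∀ k, Ω k) → ℝ≥0∞}

theorem layersOp_cons :
    layersOp μ A lam h (I :: L) = layersOp μ A lam (layerOp μ A lam I h) L := rfl

theorem layerOp_singleton :
    layerOp μ A lam {f} g = lam • (A f).indicator (refresh μ (vbl (A f)) g) := by
  simp [layerOp, vars_singleton]

theorem le_potential (ω : ∀ k, Ω k) : h ω ≤ potential μ A lam S R h ω :=
  ENNReal.le_tsum (f := fun L : {L // IsLayering A S R L} => layersOp μ A lam h L.1 ω) ⟨[], trivial⟩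

theorem tsum_pushEvent_le_potential (hf : (vbl (A f)).Nonempty) (hfS : f ∈ S) (ω : ∀ k, Ω k) :
    ∑' L : {L // IsLayering A S R L}, layersOp μ A lam h (pushEvent hfS L).1 ω ≤
      potential μ A lam S R h ω :=
  ENNReal.tsum_comp_le_tsum_of_injective (pushEvent_injective hf hfS)
    fun L : {L // IsLayering A S R L} => layersOp μ A lam h L.1 ω

variable [∀ k, IsProbabilityMeasure (μ k)]

theorem measurable_layerOp (hA : ∀ i, MeasurableSet (A i)) (hg : Measurable g) :
    Measurable (layerOp μ A lam I g) :=
  ((measurable_refresh hg).indicator (I.measurableSet_biInter fun i _ => hA i)).const_smul _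

theorem measurable_layersOp (hA : ∀ i, MeasurableSet (A i)) (hh : Measurable h) :
    Measurable (layersOp μ A lam h L) := by
  induction L generalizing h with
  | nil => exact hh
  | cons _ _ ih => exact ih (measurable_layerOp hA hh)

theorem measurable_potential [Countable ι] (hA : ∀ i, MeasurableSet (A i)) (hh : Measurable h) :
    Measurable (potential μ A lam S R h) :=
  Measurable.tsum fun _ => measurable_layersOp hA hh

theorem refresh_layerOp {T : Set (Fin n)} (hA : ∀ i, MeasurableSet (A i)) (hg : Measurable g)
    (hT : Disjoint T (vars A I)) :
    refresh μ T (layerOp μ A lam I g) = layerOp μ A lam I (refresh μ T g) := by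
  unfold layerOp
  rw [refresh_smul _ ((measurable_refresh hg).indicator (I.measurableSet_biInter fun i _ => hA i)),
    refresh_indicator (determinedBy_biInter A I) hT.symm,
    refresh_refresh hg, refresh_refresh hg, Set.union_comm]

theorem layerOp_layerOp [DecidableEq ι] (hA : ∀ i, MeasurableSet (A i)) (hg : Measurable g)
    (hIJ : Disjoint I J) (hd : Disjoint (vars A I) (vars A J)) :
    layerOp μ A lam I (layerOp μ A lam J g) = layerOp μ A lam (I ∪ J) g := by
  have hinter : (⋂ i ∈ I ∪ J, A i) = (⋂ i ∈ I, A i) ∩ ⋂ i ∈ J, A i := by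
    ext ω
    simp only [Set.mem_iInter, Finset.mem_union, Set.mem_inter_iff, or_imp, forall_and]
  calc layerOp μ A lam I (layerOp μ A lam J g)
      = lam ^ I.card • (⋂ i ∈ I, A i).indicator (layerOp μ A lam J (refresh μ (vars A I) g)) := by
        rw [layerOp, refresh_layerOp hA hg hd]
    _ = lam ^ I.card • lam ^ J.card • (⋂ i ∈ I, A i).indicator ((⋂ i ∈ J, A i).indicator
          (refresh μ (vars A J ∪ vars A I) g)) := by
        rw [layerOp, refresh_refresh hg]
        exact congrArg _ (Set.indicator_const_smul _ (lam ^ J.card) ((⋂ i ∈ J, A i).indicator _))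
    _ = layerOp μ A lam (I ∪ J) g := by
        rw [Set.indicator_indicator, smul_smul, layerOp, hinter, vars_union,
          Finset.card_union_of_disjoint hIJ, pow_add, Set.union_comm]

theorem layerOp_singleton_comm (hA : ∀ i, MeasurableSet (A i)) (hg : Measurable g)
    (hf : (vbl (A f)).Nonempty) (hd : Disjoint (vbl (A f)) (vars A I)) :
    layerOp μ A lam {f} (layerOp μ A lam I g) = layerOp μ A lam I (layerOp μ A lam {f} g) := by
  classical
  have hfI : Disjoint {f} I :=
    Finset.disjoint_singleton_left.2 (notMem_of_disjoint_vars hf hd)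
  rw [← vars_singleton] at hd
  rw [layerOp_layerOp hA hg hfI hd, layerOp_layerOp hA hg hfI.symm hd.symm, Finset.union_comm]

theorem layerOp_layersOp_of_not_meets (hA : ∀ i, MeasurableSet (A i)) (hh : Measurable h)
    (hf : (vbl (A f)).Nonempty) (hL : ¬ Meets A f L) :
    layerOp μ A lam {f} (layersOp μ A lam h L) = layersOp μ A lam (layerOp μ A lam {f} h) L := by
  induction L generalizing h with
  | nil => rfl
  | cons I L ih =>
    obtain ⟨hd, hL⟩ := not_meets_cons.1 hL
    rw [layersOp_cons, layersOp_cons, ih (measurable_layerOp hA hh) hL,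
      layerOp_singleton_comm hA hh hf hd]

theorem refresh_layersOp_of_not_meets (hA : ∀ i, MeasurableSet (A i)) (hh : Measurable h)
    (hR : refresh μ (vbl (A f)) h = h) (hL : ¬ Meets A f L) :
    refresh μ (vbl (A f)) (layersOp μ A lam h L) = layersOp μ A lam h L := by
  induction L generalizing h with
  | nil => exact hR
  | cons I L ih =>
    obtain ⟨hd, hL⟩ := not_meets_cons.1 hL
    exact ih (measurable_layerOp hA hh) (by rw [refresh_layerOp hA hh hd, hR]) hL

theorem layersOp_insertEvent (hA : ∀ i, MeasurableSet (A i)) (hh : Measurable h)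
    (hf : (vbl (A f)).Nonempty) :
    layersOp μ A lam h (insertEvent A f L) = layerOp μ A lam {f} (layersOp μ A lam h L) := by
  classical
  induction L generalizing h with
  | nil => rfl
  | cons I L ih =>
    unfold insertEvent
    split_ifs with hm
    · exact ih (measurable_layerOp hA hh)
    · obtain ⟨hd, hm⟩ := not_meets_cons.1 hm
      have hfI := Finset.disjoint_singleton_left.2 (notMem_of_disjoint_vars hf hd)
      rw [← vars_singleton] at hd
      rw [layersOp_cons, layersOp_cons,
        layerOp_layersOp_of_not_meets hA (measurable_layerOp hA hh) hf hm,
        layerOp_layerOp hA hh hfI hd, Finset.insert_eq]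

theorem layersOp_insertEvent_apply (hA : ∀ i, MeasurableSet (A i)) (hh : Measurable h)
    (hf : (vbl (A f)).Nonempty) {ω : ∀ k, Ω k} (hω : ω ∈ A f) :
    layersOp μ A lam h (insertEvent A f L) ω =
      lam * refresh μ (vbl (A f)) (layersOp μ A lam h L) ω := by
  rw [layersOp_insertEvent hA hh hf, layerOp_singleton, Pi.smul_apply, Set.indicator_of_mem hω,
    smul_eq_mul]

theorem refresh_potential [Countable ι] (hA : ∀ i, MeasurableSet (A i)) (hh : Measurable h)
    (T : Set (Fin n)) (ω : ∀ k, Ω k) :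
    refresh μ T (potential μ A lam S R h) ω =
      ∑' L : {L // IsLayering A S R L}, refresh μ T (layersOp μ A lam h L.1) ω :=
  refresh_tsum (f := fun L : {L // IsLayering A S R L} => layersOp μ A lam h L.1)
    (fun _ => measurable_layersOp hA hh) ω

theorem mul_refresh_potential_le [Countable ι] (hA : ∀ i, MeasurableSet (A i)) (hh : Measurable h)
    (hf : (vbl (A f)).Nonempty) (hfS : f ∈ S) (hR : ¬ Disjoint (vbl (A f)) R) {ω : ∀ k, Ω k}
    (hω : ω ∈ A f) :
    lam * refresh μ (vbl (A f)) (potential μ A lam S R h) ω ≤ potential μ A lam S R h ω := by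
  refine le_trans (le_of_eq ?_) (tsum_pushEvent_le_potential hf hfS ω)
  rw [refresh_potential hA hh, ← ENNReal.tsum_mul_left]
  refine tsum_congr fun L => ?_
  rw [pushEvent, dif_pos (Or.inl hR), layersOp_insertEvent_apply hA hh hf hω]

theorem refresh_potential_le [Countable ι] (hA : ∀ i, MeasurableSet (A i)) (hh : Measurable h)
    (hlam : 1 ≤ lam) (hf : (vbl (A f)).Nonempty) (hfS : f ∈ S)
    (hR : Disjoint (vbl (A f)) R → refresh μ (vbl (A f)) h = h) {ω : ∀ k, Ω k} (hω : ω ∈ A f) :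
    refresh μ (vbl (A f)) (potential μ A lam S R h) ω ≤ potential μ A lam S R h ω := by
  refine le_trans ?_ (tsum_pushEvent_le_potential hf hfS ω)
  rw [refresh_potential hA hh]
  refine ENNReal.tsum_le_tsum fun L => ?_
  unfold pushEvent
  split_ifs with hc
  · rw [layersOp_insertEvent_apply hA hh hf hω]
    exact le_mul_of_one_le_left zero_le hlam
  · rw [not_or, not_not] at hc
    rw [refresh_layersOp_of_not_meets hA hh (hR hc.1) hc.2]

theorem lintegral_layerOp (hA : ∀ i, MeasurableSet (A i)) (hg : Measurable g)
    (hI : (I : Set ι).PairwiseDisjoint fun i => vbl (A i)) :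
    ∫⁻ ω, layerOp μ A lam I g ω ∂Measure.pi μ =
      (∏ i ∈ I, lam * Measure.pi μ (A i)) * ∫⁻ ω, g ω ∂Measure.pi μ := by
  classical
  induction I using Finset.induction_on with
  | empty => simp [layerOp, vars_empty, refresh_empty]
  | insert f I hf ih =>
    rw [Finset.coe_insert, Set.pairwiseDisjoint_insert_of_notMem (by simpa using hf)] at hI
    have hd : Disjoint (vars A {f}) (vars A I) := by
      rw [vars_singleton]
      exact disjoint_vars_right.2 fun i hi => hI.2 i hi
    have hm : Measurable (layerOp μ A lam I g) := measurable_layerOp hA hg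
    rw [Finset.prod_insert hf, Finset.insert_eq,
      ← layerOp_layerOp hA hg (Finset.disjoint_singleton_left.2 hf) hd, layerOp_singleton]
    simp only [Pi.smul_apply, smul_eq_mul]
    rw [lintegral_const_mul _ ((measurable_refresh hm).indicator (hA f)),
      lintegral_indicator_refresh (hA f) (determinedBy_vbl _) hm, ih hI.1, mul_assoc, mul_assoc]

theorem lintegral_layersOp (hA : ∀ i, MeasurableSet (A i)) (hh : Measurable h)
    (hL : IsLayering A S R L) :
    ∫⁻ ω, layersOp μ A lam h L ω ∂Measure.pi μ =
      layersWeight (fun i => lam * Measure.pi μ (A i)) L * ∫⁻ ω, h ω ∂Measure.pi μ := by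
  induction L generalizing h R with
  | nil => simp [layersOp, layersWeight]
  | cons I L ih =>
    obtain ⟨-, -, hdisj, -, hL⟩ := hL
    rw [layersOp_cons, ih (measurable_layerOp hA hh) hL, lintegral_layerOp hA hh hdisj]
    simp only [layersWeight, List.map_cons, List.prod_cons]
    ring

theorem lintegral_potential [Countable ι] (hA : ∀ i, MeasurableSet (A i)) (hh : Measurable h) :
    ∫⁻ ω, potential μ A lam S R h ω ∂Measure.pi μ =
      (∑' L : {L // IsLayering A S R L},
        layersWeight (fun i => lam * Measure.pi μ (A i)) L.1) * ∫⁻ ω, h ω ∂Measure.pi μ := by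
  unfold potential
  rw [lintegral_tsum fun L => (measurable_layersOp hA hh).aemeasurable, ← ENNReal.tsum_mul_right]
  exact tsum_congr fun L => lintegral_layersOp hA hh L.2

end Potential

section LayeringSum

theorem tsum_list {α : Type*} (F : List α → ℝ≥0∞) :
    ∑' L, F L = F [] + ∑' a, ∑' L, F (a :: L) := by
  let e : Unit ⊕ (α × List α) ≃ List α :=
    { toFun := Sum.elim (fun _ => []) fun p => p.1 :: p.2
      invFun := fun
        | [] => Sum.inl ()
        | a :: L => Sum.inr (a, L)
      left_inv := by rintro (_ | _) <;> rfl
      right_inv := by rintro (_ | _) <;> rfl }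
  rw [← e.tsum_eq, Summable.tsum_sum ENNReal.summable ENNReal.summable, ← ENNReal.tsum_prod]
  simp [e]

open Classical in
/-- The indices in `S` of the events that depend on some variable in `R`. -/
noncomputable def touching (A : ι → Set (∀ k, Ω k)) (S : Finset ι) (R : Set (Fin n)) : Finset ι :=
  S.filter fun j => ¬ Disjoint (vbl (A j)) R

open Classical in
/-- The possible first layers of a layering rooted in `R`. -/
noncomputable def firstLayers (A : ι → Set (∀ k, Ω k)) (S : Finset ι) (R : Set (Fin n)) :
    Finset (Finset ι) :=
  (touching A S R).powerset.filter fun I =>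
    I.Nonempty ∧ (I : Set ι).PairwiseDisjoint fun i => vbl (A i)

variable {A : ι → Set (∀ k, Ω k)} {S : Finset ι} {R : Set (Fin n)} {I : Finset ι}
  {w y : ι → ℝ≥0∞}

theorem mem_touching {j : ι} : j ∈ touching A S R ↔ j ∈ S ∧ ¬ Disjoint (vbl (A j)) R := by
  classical exact Finset.mem_filter

theorem mem_touching_singleton {j : ι} {k : Fin n} :
    j ∈ touching A S {k} ↔ j ∈ S ∧ k ∈ vbl (A j) := by
  rw [mem_touching, Set.disjoint_singleton_right, not_not]

theorem mem_firstLayers : I ∈ firstLayers A S R ↔ I ⊆ touching A S R ∧ I.Nonempty ∧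
    (I : Set ι).PairwiseDisjoint fun i => vbl (A i) := by
  simp only [firstLayers, Finset.mem_filter, Finset.mem_powerset]

theorem isLayering_cons {L : List (Finset ι)} :
    IsLayering A S R (I :: L) ↔ I ∈ firstLayers A S R ∧ IsLayering A S (vars A I) L := by
  simp only [IsLayering, mem_firstLayers, Finset.subset_iff, mem_touching, imp_and, forall_and]
  tauto

theorem prod_touching_vars_le (I : Finset ι) :
    ∏ j ∈ touching A S (vars A I), (1 + y j) ≤
      ∏ i ∈ I, ∏ j ∈ touching A S (vbl (A i)), (1 + y j) := by
  classical
  induction I using Finset.induction_on with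
  | empty => simp [touching, vars_empty]
  | insert f I hf ih =>
    have hunion : touching A S (vars A (insert f I)) =
        touching A S (vbl (A f)) ∪ touching A S (vars A I) := by
      ext j
      simp only [mem_touching, vars_insert, Finset.mem_union, Set.disjoint_union_right,
        not_and_or, ← and_or_left]
    rw [hunion, Finset.prod_insert hf]
    refine le_trans ?_ (mul_le_mul_right ih _)
    rw [← Finset.prod_union_inter]
    exact le_mul_of_one_le_right zero_le (Finset.one_le_prod' fun j _ => le_self_add)

theorem one_add_sum_firstLayers_le :
    1 + ∑ I ∈ firstLayers A S R, ∏ i ∈ I, y i ≤ ∏ j ∈ touching A S R, (1 + y j) := by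
  classical
  rw [Finset.prod_one_add, ← Finset.sum_erase_add _ _ (Finset.empty_mem_powerset _),
    Finset.prod_empty, add_comm]
  gcongr
  intro I hI
  obtain ⟨hsub, hne, -⟩ := mem_firstLayers.1 hI
  exact Finset.mem_erase.2 ⟨hne.ne_empty, Finset.mem_powerset.2 hsub⟩

/-- Events that share the variable `k` are never in the same layer. -/
theorem sum_firstLayers_singleton_le (k : Fin n) :
    ∑ I ∈ firstLayers A S {k}, ∏ i ∈ I, y i ≤ ∑ j ∈ touching A S {k}, y j := by
  classical
  have hsub : firstLayers A S {k} ⊆ (touching A S {k}).image fun j => {j} := by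
    intro I hI
    obtain ⟨hsub, ⟨i, hi⟩, hdisj⟩ := mem_firstLayers.1 hI
    refine Finset.mem_image.2 ⟨i, hsub hi, (Finset.eq_singleton_iff_unique_mem.2
      ⟨hi, fun j hj => ?_⟩).symm⟩
    by_contra hne
    have hmem : ∀ l ∈ I, k ∈ vbl (A l) := fun l hl => (mem_touching_singleton.1 (hsub hl)).2
    exact Set.disjoint_left.1 (hdisj hj hi hne) (hmem j hj) (hmem i hi)
  refine (Finset.sum_le_sum_of_subset hsub).trans ?_
  rw [Finset.sum_image fun a _ b _ h => Finset.singleton_injective h]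
  simp only [Finset.prod_singleton, le_refl]

open Classical in
theorem tsum_layersWeight_length_lt_le [Finite ι]
    (hw : ∀ i ∈ S, w i * ∏ j ∈ touching A S (vbl (A i)), (1 + y j) ≤ y i) (d : ℕ) :
    ∑' L : List (Finset ι), (if IsLayering A S R L ∧ L.length < d then layersWeight w L else 0) ≤
      1 + ∑ I ∈ firstLayers A S R, ∏ i ∈ I, y i := by
  induction d generalizing R with
  | zero => simp
  | succ d ih =>
    rw [tsum_list, tsum_eq_sum (s := firstLayers A S R) fun I hI => by simp [isLayering_cons, hI]]
    refine add_le_add (by simp [IsLayering, layersWeight]) (Finset.sum_le_sum fun I hI => ?_)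
    have hIS : ∀ i ∈ I, i ∈ S := fun i hi => (mem_touching.1 ((mem_firstLayers.1 hI).1 hi)).1
    calc ∑' L : List (Finset ι), (if IsLayering A S R (I :: L) ∧ (I :: L).length < d + 1 then
            layersWeight w (I :: L) else 0)
        = (∏ i ∈ I, w i) * ∑' L : List (Finset ι),
            (if IsLayering A S (vars A I) L ∧ L.length < d then layersWeight w L else 0) := by
          rw [← ENNReal.tsum_mul_left]
          refine tsum_congr fun L => ?_
          simp only [isLayering_cons, hI, true_and, List.length_cons, add_lt_add_iff_right,
            mul_ite, mul_zero, layersWeight, List.map_cons, List.prod_cons]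
      _ ≤ (∏ i ∈ I, w i) * ∏ j ∈ touching A S (vars A I), (1 + y j) :=
          mul_le_mul_right (ih.trans one_add_sum_firstLayers_le) _
      _ ≤ (∏ i ∈ I, w i) * ∏ i ∈ I, ∏ j ∈ touching A S (vbl (A i)), (1 + y j) :=
          mul_le_mul_right (prod_touching_vars_le I) _
      _ ≤ ∏ i ∈ I, y i := by
          rw [← Finset.prod_mul_distrib]
          exact Finset.prod_le_prod' fun i hi => hw i (hIS i hi)

theorem tsum_layersWeight_le [Finite ι]
    (hw : ∀ i ∈ S, w i * ∏ j ∈ touching A S (vbl (A i)), (1 + y j) ≤ y i) :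
    ∑' L : {L // IsLayering A S R L}, layersWeight w L.1 ≤
      1 + ∑ I ∈ firstLayers A S R, ∏ i ∈ I, y i := by
  classical
  rw [ENNReal.tsum_eq_iSup_sum]
  refine iSup_le fun T => ?_
  let d := T.sup (fun L => L.1.length) + 1
  let F : List (Finset ι) → ℝ≥0∞ := fun L =>
    if IsLayering A S R L ∧ L.length < d then layersWeight w L else 0
  calc ∑ L ∈ T, layersWeight w L.1
      = ∑ L ∈ T, F L.1 := Finset.sum_congr rfl fun L hL =>
        (if_pos ⟨L.2, Nat.lt_succ_of_le (Finset.le_sup (f := fun L => L.1.length) hL)⟩).symm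
    _ ≤ ∑' L : {L // IsLayering A S R L}, F L.1 := ENNReal.sum_le_tsum T
    _ ≤ ∑' L, F L := ENNReal.tsum_comp_le_tsum_of_injective Subtype.val_injective F
    _ ≤ 1 + ∑ I ∈ firstLayers A S R, ∏ i ∈ I, y i := tsum_layersWeight_length_lt_le hw d

end LayeringSum

theorem measurePreserving_update_infinitePi {J : Type*} [DecidableEq J] {X : J → Type*}
    [∀ j, MeasurableSpace (X j)] (ν : ∀ j, Measure (X j)) [∀ j, IsProbabilityMeasure (ν j)]
    (t : J) :
    MeasurePreserving (fun p : (∀ j, X j) × X t => Function.update p.1 t p.2)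
      ((Measure.infinitePi ν).prod (ν t)) (Measure.infinitePi ν) := by
  refine ⟨measurable_update', Measure.eq_infinitePi _ fun s B hB => ?_⟩
  have hpre : (fun p : (∀ j, X j) × X t => Function.update p.1 t p.2) ⁻¹' Set.pi s B =
      Set.pi (s.erase t) B ×ˢ {a | t ∈ s → a ∈ B t} := by
    ext ⟨ξ, a⟩
    simp only [Set.mem_preimage, Set.mem_pi, Set.mem_prod, Finset.mem_coe, Finset.mem_erase,
      and_imp, Set.mem_ofPred_eq]
    rw [Function.forall_update_iff ξ fun j x => j ∈ s → x ∈ B j]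
    tauto
  rw [Measure.map_apply measurable_update' (.pi s.countable_toSet fun i _ => hB i), hpre,
    Measure.prod_prod, Measure.infinitePi_pi _ fun i _ => hB i]
  by_cases ht : t ∈ s
  · simpa [ht] using Finset.prod_erase_mul s (fun j => ν j (B j)) ht
  · simp [ht]

section Loop

variable [∀ k, MeasurableSpace (Ω k)] {A : ι → Set (∀ k, Ω k)} {S : Finset ι} (V : Verifier A S)

theorem mtLoop_of_find_none (ξ : ℕ → ∀ k, Ω k) (K t : ℕ) {ω : ∀ k, Ω k} (h : V.find ω = none) :
    mtLoop V ξ K t ω = ⟨some ω, 0, V.cost ω⟩ := by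
  cases K <;> simp [mtLoop, h]

theorem mtLoop_zero_of_find_some (ξ : ℕ → ∀ k, Ω k) (t : ℕ) {ω : ∀ k, Ω k} {i : ι}
    (h : V.find ω = some i) : mtLoop V ξ 0 t ω = ⟨none, 0, V.cost ω⟩ := by
  simp [mtLoop, h]

theorem result_mtLoop_succ_of_find_some (ξ : ℕ → ∀ k, Ω k) (K t : ℕ) {ω : ∀ k, Ω k} {i : ι}
    (h : V.find ω = some i) :
    (mtLoop V ξ (K + 1) t ω).result =
      (mtLoop V ξ K (t + 1) (resample (vbl (A i)) ω (ξ t))).result := by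
  simp [mtLoop, h]

theorem mtLoop_congr {ξ ξ' : ℕ → ∀ k, Ω k} (K t : ℕ) (ω : ∀ k, Ω k)
    (h : ∀ s, t ≤ s → ξ s = ξ' s) : mtLoop V ξ K t ω = mtLoop V ξ' K t ω := by
  fun_induction mtLoop V ξ K t ω with
  | case1 _ _ hf => simp [mtLoop, hf]
  | case2 _ _ _ hf => simp [mtLoop, hf]
  | case3 _ _ _ hf => simp [mtLoop, hf]
  | case4 K t ω i hf rest ih =>
    simp only [mtLoop, hf, rest, ih fun s hs => h s (by omega), h t le_rfl]

theorem resamplings_mtLoop_le (ξ : ℕ → ∀ k, Ω k) (K t : ℕ) (ω : ∀ k, Ω k) :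
    (mtLoop V ξ K t ω).resamplings ≤ K := by
  fun_induction mtLoop V ξ K t ω with
  | case1 | case2 | case3 => exact Nat.zero_le _
  | case4 _ _ _ _ _ _ ih => exact Nat.succ_le_succ ih

theorem steps_mtLoop_le {τ : ℕ} (hτ : ∀ ω, V.cost ω ≤ τ) (ξ : ℕ → ∀ k, Ω k) (K t : ℕ)
    (ω : ∀ k, Ω k) : (mtLoop V ξ K t ω).steps ≤ K * (n + τ) + τ := by
  fun_induction mtLoop V ξ K t ω with
  | case1 _ ω _ => simpa using hτ ω
  | case2 _ ω _ _ => simpa using hτ ω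
  | case3 _ _ ω _ => exact (hτ ω).trans (Nat.le_add_left _ _)
  | case4 K _ ω i _ rest ih =>
    have hcard : (vbl (A i)).ncard ≤ n := by simpa using Set.ncard_le_card (vbl (A i))
    calc V.cost ω + (vbl (A i)).ncard + rest.steps ≤ τ + n + (K * (n + τ) + τ) := by
          gcongr; exact hτ ω
      _ = (K + 1) * (n + τ) + τ := by ring

theorem find_eq_none_of_result_mtLoop (ξ : ℕ → ∀ k, Ω k) (K t : ℕ) (ω : ∀ k, Ω k) {ω' : ∀ k, Ω k}
    (h : (mtLoop V ξ K t ω).result = some ω') : V.find ω' = none := by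
  fun_induction mtLoop V ξ K t ω with
  | case1 _ _ hf => exact Option.some.inj h ▸ hf
  | case2 => simp at h
  | case3 _ _ _ hf => exact Option.some.inj h ▸ hf
  | case4 _ _ _ _ _ _ ih => exact ih h

theorem notMem_of_result_mtLoop {ξ : ℕ → ∀ k, Ω k} {K t : ℕ} {ω ω' : ∀ k, Ω k}
    (h : (mtLoop V ξ K t ω).result = some ω') : ∀ i ∈ S, ω' ∉ A i :=
  V.notMem_of_find ω' (find_eq_none_of_result_mtLoop V ξ K t ω h)

variable [Finite ι]

theorem Verifier.measurableSet_find_eq (o : Option ι) : MeasurableSet {ω | V.find ω = o} := by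
  cases o with
  | some i => exact V.measurable_find i
  | none =>
    have hcompl : {ω | V.find ω = none} = (⋃ i, {ω | V.find ω = some i})ᶜ := by
      ext ω
      simp [Option.eq_none_iff_forall_ne_some]
    rw [hcompl]
    exact (MeasurableSet.iUnion V.measurable_find).compl

theorem Verifier.measurableSet_of_find {X : Type*} [MeasurableSpace X] {f : X → ∀ k, Ω k}
    (hf : Measurable f) {U : Set X} {W : Option ι → Set X} (hW : ∀ o, MeasurableSet (W o))
    (hUW : ∀ p o, V.find (f p) = o → (p ∈ U ↔ p ∈ W o)) : MeasurableSet U := by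
  have hU : U = ⋃ o, f ⁻¹' {ω | V.find ω = o} ∩ W o := by
    ext p
    simp [hUW p _ rfl]
  rw [hU]
  exact MeasurableSet.iUnion fun o => (hf (V.measurableSet_find_eq o)).inter (hW o)

theorem measurableSet_result_mtLoop {E : Set (Option (∀ k, Ω k))}
    (hE : MeasurableSet {ω | some ω ∈ E}) (K t : ℕ) :
    MeasurableSet {p : (∀ k, Ω k) × (ℕ → ∀ k, Ω k) | (mtLoop V p.2 K t p.1).result ∈ E} := by
  induction K generalizing t with
  | zero =>
    refine V.measurableSet_of_find measurable_fst (W := fun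
      | none => {p | some p.1 ∈ E}
      | some _ => {_p | none ∈ E}) ?_ ?_
    · rintro (_ | _)
      exacts [measurable_fst hE, .const _]
    · rintro p (_ | i) hf
      · simp [mtLoop_of_find_none V _ _ _ hf]
      · simp [mtLoop_zero_of_find_some V _ _ hf]
  | succ K ih =>
    refine V.measurableSet_of_find measurable_fst (W := fun
      | none => {p | some p.1 ∈ E}
      | some i => (fun p => (resample (vbl (A i)) p.1 (p.2 t), p.2)) ⁻¹'
          {p | (mtLoop V p.2 K (t + 1) p.1).result ∈ E}) ?_ ?_
    · rintro (_ | i)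
      · exact measurable_fst hE
      · exact (((measurable_resample (vbl (A i))).comp (measurable_fst.prodMk
          ((measurable_pi_apply t).comp measurable_snd))).prodMk measurable_snd) (ih (t + 1))
    · rintro p (_ | i) hf
      · simp [mtLoop_of_find_none V _ _ _ hf]
      · simp [result_mtLoop_succ_of_find_some V _ _ _ hf]

variable {μ : ∀ k, Measure (Ω k)} [∀ k, IsProbabilityMeasure (μ k)]

instance : IsProbabilityMeasure (sampleLaw μ) := by
  unfold sampleLaw
  infer_instance

theorem sampleLaw_eq_lintegral {U : Set (ℕ → ∀ k, Ω k)} (hU : MeasurableSet U) (t : ℕ) :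
    sampleLaw μ U = ∫⁻ η, sampleLaw μ {ξ | Function.update ξ t η ∈ U} ∂Measure.pi μ := by
  have h := measurePreserving_update_infinitePi (fun _ : ℕ => Measure.pi μ) t
  rw [sampleLaw, ← h.measure_preimage hU.nullMeasurableSet,
    Measure.prod_apply_symm (h.measurable hU)]
  rfl

theorem sampleLaw_mtLoop_succ {E : Set (Option (∀ k, Ω k))}
    (hE : MeasurableSet {ω | some ω ∈ E}) (K t : ℕ) {ω : ∀ k, Ω k} {i : ι}
    (h : V.find ω = some i) :
    sampleLaw μ {ξ | (mtLoop V ξ (K + 1) t ω).result ∈ E} =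
      refresh μ (vbl (A i))
        (fun ω' => sampleLaw μ {ξ | (mtLoop V ξ K (t + 1) ω').result ∈ E}) ω := by
  have hU : MeasurableSet {ξ | (mtLoop V ξ (K + 1) t ω).result ∈ E} :=
    measurable_prodMk_left (x := ω) (measurableSet_result_mtLoop V hE (K + 1) t)
  rw [sampleLaw_eq_lintegral hU t]
  refine lintegral_congr fun η => congrArg (sampleLaw μ) (Set.ext fun ξ => ?_)
  simp only [Set.mem_ofPred_eq, result_mtLoop_succ_of_find_some V _ _ _ h, Function.update_self]
  rw [mtLoop_congr V K (t + 1) _ fun s hs => Function.update_of_ne (by omega) η ξ]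

theorem measurableSet_result_moserTardos {E : Set (Option (∀ k, Ω k))}
    (hE : MeasurableSet {ω | some ω ∈ E}) (K : ℕ) :
    MeasurableSet {ξ | (moserTardos V K ξ).result ∈ E} := by
  have hpair : Measurable fun ξ : ℕ → ∀ k, Ω k => (ξ 0, ξ) :=
    (measurable_pi_apply 0).prodMk measurable_id
  exact hpair (measurableSet_result_mtLoop V hE K 1)

theorem sampleLaw_moserTardos {E : Set (Option (∀ k, Ω k))}
    (hE : MeasurableSet {ω | some ω ∈ E}) (K : ℕ) :
    sampleLaw μ {ξ | (moserTardos V K ξ).result ∈ E} =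
      ∫⁻ ω, sampleLaw μ {ξ | (mtLoop V ξ K 1 ω).result ∈ E} ∂Measure.pi μ := by
  rw [sampleLaw_eq_lintegral (measurableSet_result_moserTardos V hE K) 0]
  refine lintegral_congr fun η => congrArg (sampleLaw μ) (Set.ext fun ξ => ?_)
  simp only [Set.mem_ofPred_eq, moserTardos, Function.update_self]
  rw [mtLoop_congr V K 1 _ fun s hs => Function.update_of_ne (by omega) η ξ]

/-- `P K` holds the potential functions that may be in use when `K` resamplings are left; which one
is in use at a time may depend on the events resampled so far. -/
theorem sampleLaw_mtLoop_le {E : Set (Option (∀ k, Ω k))} (hE : MeasurableSet {ω | some ω ∈ E})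
    {P : ℕ → Set ((∀ k, Ω k) → ℝ≥0∞)}
    (hreturn : ∀ K, ∀ Φ ∈ P K, ∀ ω, some ω ∈ E → 1 ≤ Φ ω)
    (hgiveUp : none ∈ E → ∀ Φ ∈ P 0, ∀ ω, 1 ≤ Φ ω)
    (hstep : ∀ K, ∀ Φ ∈ P (K + 1), ∀ i ∈ S, ∃ Φ' ∈ P K,
      ∀ ω ∈ A i, refresh μ (vbl (A i)) Φ' ω ≤ Φ ω)
    (K t : ℕ) {Φ : (∀ k, Ω k) → ℝ≥0∞} (hΦ : Φ ∈ P K) (ω : ∀ k, Ω k) :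
    sampleLaw μ {ξ | (mtLoop V ξ K t ω).result ∈ E} ≤ Φ ω := by
  have of_mem : ∀ (o : Option (∀ k, Ω k)) (a : ℝ≥0∞), (o ∈ E → 1 ≤ a) →
      sampleLaw μ {_ξ | o ∈ E} ≤ a := fun o a ho => by
    by_cases hoE : o ∈ E
    · exact prob_le_one.trans (ho hoE)
    · simp [hoE]
  induction K generalizing t ω Φ with
  | zero =>
    cases hf : V.find ω with
    | none =>
      simp only [mtLoop_of_find_none V _ _ _ hf]
      exact of_mem _ _ (hreturn 0 Φ hΦ ω)
    | some i =>
      simp only [mtLoop_zero_of_find_some V _ _ hf]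
      exact of_mem _ _ fun h => hgiveUp h Φ hΦ ω
  | succ K ih =>
    cases hf : V.find ω with
    | none =>
      simp only [mtLoop_of_find_none V _ _ _ hf]
      exact of_mem _ _ (hreturn (K + 1) Φ hΦ ω)
    | some i =>
      obtain ⟨hiS, hω⟩ := V.mem_of_find ω i hf
      obtain ⟨Φ', hΦ', hle⟩ := hstep K Φ hΦ i hiS
      rw [sampleLaw_mtLoop_succ V hE K t hf]
      exact (refresh_mono (fun ω' => ih (t + 1) hΦ' ω') _ ω).trans (hle ω hω)

end Loop

section OutputBounds

variable [∀ k, MeasurableSpace (Ω k)] {μ : ∀ k, Measure (Ω k)} {A : ι → Set (∀ k, Ω k)}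
  {S : Finset ι} {lam : ℝ≥0∞} {y : ι → ℝ≥0∞}

/-- The potential that bounds the probability of giving up, when `a k` counts how often variable `k`
has been resampled so far: some `a k` has to reach `m` before more than `n * m` resamplings can take
place. -/
noncomputable def giveUpPotential (μ : ∀ k, Measure (Ω k)) (A : ι → Set (∀ k, Ω k)) (lam : ℝ≥0∞)
    (S : Finset ι) (m : ℕ) (a : Fin n → ℕ) : (∀ k, Ω k) → ℝ≥0∞ :=
  (lam ^ m)⁻¹ • ∑ k, lam ^ a k • potential μ A lam S {k} 1

theorem one_le_giveUpPotential (hn : 0 < n) (hlam : 1 ≤ lam) (hlam' : lam ≠ ∞) {m : ℕ}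
    {a : Fin n → ℕ} (ha : n * m ≤ ∑ k, a k) (ω : ∀ k, Ω k) :
    1 ≤ giveUpPotential μ A lam S m a ω := by
  have : NeZero n := ⟨hn.ne'⟩
  obtain ⟨k, -, hk⟩ : ∃ k ∈ Finset.univ, m ≤ a k :=
    Finset.exists_le_of_sum_le Finset.univ_nonempty (by simpa using ha)
  have hm0 : lam ^ m ≠ 0 := pow_ne_zero m (zero_lt_one.trans_le hlam).ne'
  simp only [giveUpPotential, Pi.smul_apply, Finset.sum_apply, smul_eq_mul]
  calc 1 = (lam ^ m)⁻¹ * lam ^ m := (ENNReal.inv_mul_cancel hm0 (ENNReal.pow_ne_top hlam')).symm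
    _ ≤ (lam ^ m)⁻¹ * (lam ^ a k * potential μ A lam S {k} 1 ω) := by
        gcongr
        exact (pow_le_pow_right₀ hlam hk).trans (le_mul_of_one_le_right' (le_potential ω))
    _ ≤ (lam ^ m)⁻¹ * ∑ k, lam ^ a k * potential μ A lam S {k} 1 ω := by
        gcongr
        exact Finset.single_le_sum (f := fun k => lam ^ a k * potential μ A lam S {k} 1 ω)
          (fun _ _ => zero_le) (Finset.mem_univ k)

variable [Finite ι] [∀ k, IsProbabilityMeasure (μ k)]

theorem sampleLaw_moserTardos_mem_le (V : Verifier A S) (hA : ∀ i, MeasurableSet (A i))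
    (hne : ∀ i ∈ S, (vbl (A i)).Nonempty)
    (hy : ∀ i ∈ S, Measure.pi μ (A i) * ∏ j ∈ touching A S (vbl (A i)), (1 + y j) ≤ y i)
    {B : Set (∀ k, Ω k)} (hB : MeasurableSet B) (K : ℕ) :
    sampleLaw μ {ξ | (moserTardos V K ξ).result ∈ some '' B} ≤
      Measure.pi μ B * ∏ j ∈ touching A S (vbl B), (1 + y j) := by
  have hE : MeasurableSet {ω | some ω ∈ some '' B} := by simpa using hB
  have hh : Measurable (B.indicator (1 : (∀ k, Ω k) → ℝ≥0∞)) := measurable_one.indicator hB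
  have hloop : ∀ ω, sampleLaw μ {ξ | (mtLoop V ξ K 1 ω).result ∈ some '' B} ≤
      potential μ A 1 S (vbl B) (B.indicator 1) ω := by
    refine sampleLaw_mtLoop_le V hE (P := fun _ => {potential μ A 1 S (vbl B) (B.indicator 1)})
      ?_ (fun hnone => by simp at hnone) ?_ K 1 rfl
    · rintro _ _ rfl ω ⟨ω', hω', hωω'⟩
      cases hωω'
      exact (Set.indicator_of_mem hω' 1).ge.trans (le_potential ω)
    · rintro _ _ rfl i hi
      exact ⟨_, rfl, fun ω hω => refresh_potential_le hA hh le_rfl (hne i hi) hi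
        (fun hd => by rw [refresh_indicator (determinedBy_vbl B) hd.symm, refresh_one]) hω⟩
  have hweight : ∑' L : {L // IsLayering A S (vbl B) L},
      layersWeight (fun i => 1 * Measure.pi μ (A i)) L.1 ≤
        ∏ j ∈ touching A S (vbl B), (1 + y j) := by
    simp only [one_mul]
    exact (tsum_layersWeight_le hy).trans one_add_sum_firstLayers_le
  calc sampleLaw μ {ξ | (moserTardos V K ξ).result ∈ some '' B}
      = ∫⁻ ω, sampleLaw μ {ξ | (mtLoop V ξ K 1 ω).result ∈ some '' B} ∂Measure.pi μ :=
        sampleLaw_moserTardos V hE K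
    _ ≤ ∫⁻ ω, potential μ A 1 S (vbl B) (B.indicator 1) ω ∂Measure.pi μ := lintegral_mono hloop
    _ = (∑' L : {L // IsLayering A S (vbl B) L},
          layersWeight (fun i => 1 * Measure.pi μ (A i)) L.1) * Measure.pi μ B := by
        rw [lintegral_potential hA hh, lintegral_indicator_one hB]
    _ ≤ Measure.pi μ B * ∏ j ∈ touching A S (vbl B), (1 + y j) := by
        rw [mul_comm]
        gcongr

theorem refresh_giveUpPotential_le (hA : ∀ i, MeasurableSet (A i)) (hlam : 1 ≤ lam) {i : ι}
    (hi : i ∈ S) (hne : (vbl (A i)).Nonempty) (m : ℕ) (a : Fin n → ℕ) {ω : ∀ k, Ω k}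
    (hω : ω ∈ A i) :
    refresh μ (vbl (A i)) (giveUpPotential μ A lam S m (a + (vbl (A i)).indicator 1)) ω ≤
      giveUpPotential μ A lam S m a ω := by
  have hpot : ∀ k, Measurable (potential μ A lam S {k} 1) := fun k =>
    measurable_potential hA measurable_one
  have hterm : ∀ k, Measurable
      (lam ^ (a k + (vbl (A i)).indicator 1 k) • potential μ A lam S {k} 1) := fun k =>
    (hpot k).const_smul _
  have hsum : Measurable (∑ k, lam ^ (a k + (vbl (A i)).indicator 1 k) •
      potential μ A lam S {k} 1) := by
    rw [Finset.sum_fn]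
    exact Finset.measurable_fun_sum _ fun k _ => hterm k
  simp only [giveUpPotential, Pi.add_apply, refresh_smul _ hsum, refresh_sum fun k _ => hterm k,
    refresh_smul _ (hpot _), Pi.smul_apply, Finset.sum_apply, smul_eq_mul]
  gcongr _ * ∑ k, ?_ with k
  by_cases hk : k ∈ vbl (A i)
  · have hdrop := mul_refresh_potential_le (μ := μ) (lam := lam) (R := {k}) hA measurable_one hne hi
      (by simpa using hk) hω
    simp only [Set.indicator_of_mem hk, Pi.one_apply, pow_succ, mul_assoc]
    gcongr
  · simp only [Set.indicator_of_notMem hk, add_zero]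
    gcongr
    exact refresh_potential_le hA measurable_one hlam hne hi (fun _ => refresh_one) hω

theorem lintegral_giveUpPotential_zero_le (hA : ∀ i, MeasurableSet (A i))
    (hy : ∀ i ∈ S, lam * Measure.pi μ (A i) * ∏ j ∈ touching A S (vbl (A i)), (1 + y j) ≤ y i)
    (m : ℕ) :
    ∫⁻ ω, giveUpPotential μ A lam S m 0 ω ∂Measure.pi μ ≤
      (lam ^ m)⁻¹ * ∑ k, (1 + ∑ j ∈ touching A S {k}, y j) := by
  have hpot : ∀ k, Measurable (potential μ A lam S {k} 1) := fun k =>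
    measurable_potential hA measurable_one
  simp only [giveUpPotential, Pi.zero_apply, pow_zero, one_smul, Pi.smul_apply, Finset.sum_apply,
    smul_eq_mul]
  rw [lintegral_const_mul _ (Finset.measurable_fun_sum _ fun k _ => hpot k),
    lintegral_finsetSum _ fun k _ => hpot k]
  gcongr with k
  calc ∫⁻ ω, potential μ A lam S {k} 1 ω ∂Measure.pi μ
      = ∑' L : {L // IsLayering A S {k} L},
          layersWeight (fun i => lam * Measure.pi μ (A i)) L.1 := by
        simp [lintegral_potential hA measurable_one]
    _ ≤ 1 + ∑ j ∈ touching A S {k}, y j :=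
        (tsum_layersWeight_le hy).trans (add_le_add_right (sum_firstLayers_singleton_le k) 1)

theorem sampleLaw_moserTardos_none_le (V : Verifier A S) (hA : ∀ i, MeasurableSet (A i))
    (hn : 0 < n) (hne : ∀ i ∈ S, (vbl (A i)).Nonempty) (hlam : 1 ≤ lam) (hlam' : lam ≠ ∞)
    (hy : ∀ i ∈ S, lam * Measure.pi μ (A i) * ∏ j ∈ touching A S (vbl (A i)), (1 + y j) ≤ y i)
    {m K : ℕ} (hm : n * m ≤ K) :
    sampleLaw μ {ξ | (moserTardos V K ξ).result = none} ≤
      (lam ^ m)⁻¹ * ∑ k, (1 + ∑ j ∈ touching A S {k}, y j) := by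
  have hE : MeasurableSet {ω : ∀ k, Ω k | some ω ∈ ({none} : Set (Option (∀ k, Ω k)))} := by simp
  have hloop : ∀ ω, sampleLaw μ {ξ | (mtLoop V ξ K 1 ω).result ∈ ({none} : Set _)} ≤
      giveUpPotential μ A lam S m 0 ω := by
    refine sampleLaw_mtLoop_le V hE
      (P := fun K => {Φ | ∃ a : Fin n → ℕ, n * m ≤ K + ∑ k, a k ∧
        Φ = giveUpPotential μ A lam S m a})
      (fun _ _ _ _ hsome => by simp at hsome) ?_ ?_ K 1 ⟨0, by simpa using hm, rfl⟩
    · rintro - _ ⟨a, ha, rfl⟩ ω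
      exact one_le_giveUpPotential hn hlam hlam' (by simpa using ha) ω
    · rintro K _ ⟨a, ha, rfl⟩ i hi
      refine ⟨_, ⟨a + (vbl (A i)).indicator 1, ?_, rfl⟩,
        fun ω hω => refresh_giveUpPotential_le hA hlam hi (hne i hi) m a hω⟩
      obtain ⟨k, hk⟩ := hne i hi
      have hone : 1 ≤ ∑ k, (vbl (A i)).indicator (1 : Fin n → ℕ) k :=
        (Set.indicator_of_mem hk (1 : Fin n → ℕ)).ge.trans
          (Finset.single_le_sum (fun _ _ => Nat.zero_le _) (Finset.mem_univ k))
      simp only [Pi.add_apply, Finset.sum_add_distrib]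
      omega
  calc sampleLaw μ {ξ | (moserTardos V K ξ).result = none}
      = ∫⁻ ω, sampleLaw μ {ξ | (mtLoop V ξ K 1 ω).result ∈ ({none} : Set _)} ∂Measure.pi μ :=
        sampleLaw_moserTardos V hE K
    _ ≤ ∫⁻ ω, giveUpPotential μ A lam S m 0 ω ∂Measure.pi μ := lintegral_mono hloop
    _ ≤ _ := lintegral_giveUpPotential_zero_le hA hy m

end OutputBounds

section ExpSlack

theorem eq_empty_or_univ_of_vbl_eq_empty {B : Set (∀ k, Ω k)} (h : vbl B = ∅) :
    B = ∅ ∨ B = Set.univ := by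
  refine B.eq_empty_or_nonempty.imp_right fun ⟨ω, hω⟩ => Set.eq_univ_of_forall fun ω' => ?_
  exact (determinedBy_vbl B ω ω' (by simp [h])).1 hω

theorem touching_mono {A : ι → Set (∀ k, Ω k)} {S S' : Finset ι} {R R' : Set (Fin n)}
    (hS : S ⊆ S') (hR : R ⊆ R') : touching A S R ⊆ touching A S' R' := fun j hj => by
  obtain ⟨hjS, hjR⟩ := mem_touching.1 hj
  exact mem_touching.2 ⟨hS hjS, fun hd => hjR (hd.mono_right hR)⟩

variable [Fintype ι] {A : ι → Set (∀ k, Ω k)} {S : Finset ι} {x : ι → ℝ} {i : ι}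

theorem mem_nbhd {j : ι} : j ∈ nbhd A i ↔ j ≠ i ∧ ¬ Disjoint (vbl (A j)) (vbl (A i)) := by
  simp [nbhd, Set.not_disjoint_iff_nonempty_inter]

theorem touching_subset_nbhd (hi : i ∉ S) : touching A S (vbl (A i)) ⊆ nbhd A i := fun j hj => by
  obtain ⟨hjS, hj⟩ := mem_touching.1 hj
  exact mem_nbhd.2 ⟨fun hji => hi (hji ▸ hjS), hj⟩

theorem touching_subset_insert_nbhd [DecidableEq ι] :
    touching A S (vbl (A i)) ⊆ insert i (nbhd A i) := fun j hj => by
  rw [Finset.mem_insert, or_iff_not_imp_left]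
  exact fun hji => mem_nbhd.2 ⟨hji, (mem_touching.1 hj).2⟩

theorem delta_le (i : ι) : delta A x ≤ lllBound A x i :=
  ciInf_le (Set.finite_range _).bddBelow i

/-- The weights of the events in the layerings: `1 + odds x i = 1 / (1 - x i)`. -/
noncomputable def odds (x : ι → ℝ) (i : ι) : ℝ≥0∞ :=
  ENNReal.ofReal (x i / (1 - x i))

variable [∀ k, MeasurableSpace (Ω k)] {μ : ∀ k, Measure (Ω k)} {ε p : ℝ}

theorem mem_core : i ∈ core μ A p ↔ p ≤ prob μ (A i) := by
  simp [core]

theorem prob_nonneg (μ : ∀ k, Measure (Ω k)) (B : Set (∀ k, Ω k)) : 0 ≤ prob μ B :=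
  measureReal_nonneg

namespace ExpSlack

theorem eps_lt_one (h : ExpSlack μ A ε x) (i : ι) : ε < 1 := by
  linarith [h.pos i, h.lt i]

theorem one_sub_pos (h : ExpSlack μ A ε x) (hε : 0 < ε) (i : ι) : 0 < 1 - x i := by
  linarith [h.lt i]

theorem prod_one_sub_pos (h : ExpSlack μ A ε x) (hε : 0 < ε) (T : Finset ι) :
    0 < ∏ j ∈ T, (1 - x j) :=
  Finset.prod_pos fun j _ => h.one_sub_pos hε j

theorem lllBound_pos (h : ExpSlack μ A ε x) (hε : 0 < ε) (i : ι) : 0 < lllBound A x i :=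
  mul_pos (h.pos i) (h.prod_one_sub_pos hε _)

theorem lllBound_le (h : ExpSlack μ A ε x) (hε : 0 < ε) (i : ι) : lllBound A x i ≤ x i :=
  mul_le_of_le_one_right (h.pos i).le
    (Finset.prod_le_one (fun j _ => (h.one_sub_pos hε j).le) fun j _ => by linarith [h.pos j])

theorem delta_pos [Nonempty ι] (h : ExpSlack μ A ε x) (hε : 0 < ε) : 0 < delta A x := by
  obtain ⟨j, hj⟩ := exists_eq_ciInf_of_finite (f := lllBound A x)
  exact (h.lllBound_pos hε j).trans_eq hj

theorem log_one_div_delta_nonneg (h : ExpSlack μ A ε x) (hε : 0 < ε) :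
    0 ≤ Real.log (1 / delta A x) := by
  rcases isEmpty_or_nonempty ι with _ | ⟨⟨i⟩⟩
  · simp [delta, Real.iInf_of_isEmpty]
  · have : Nonempty ι := ⟨i⟩
    refine Real.log_nonneg ((one_le_div (h.delta_pos hε)).2 ?_)
    linarith [delta_le (A := A) (x := x) i, h.lllBound_le hε i, h.lt i]

theorem sum_nbhd_le (h : ExpSlack μ A ε x) (hε : 0 < ε) (i : ι) :
    ∑ j ∈ nbhd A i, x j ≤ Real.log (1 / delta A x) := by
  have : Nonempty ι := ⟨i⟩
  have hexp : delta A x ≤ Real.exp (-∑ j ∈ nbhd A i, x j) := by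
    calc delta A x ≤ x i * ∏ j ∈ nbhd A i, (1 - x j) := delta_le i
      _ ≤ ∏ j ∈ nbhd A i, (1 - x j) :=
        mul_le_of_le_one_left (h.prod_one_sub_pos hε _).le (by linarith [h.lt i])
      _ ≤ ∏ j ∈ nbhd A i, Real.exp (-x j) :=
        Finset.prod_le_prod (fun j _ => (h.one_sub_pos hε j).le)
          fun j _ => Real.one_sub_le_exp_neg (x j)
      _ = Real.exp (-∑ j ∈ nbhd A i, x j) := by rw [← Real.exp_sum, Finset.sum_neg_distrib]
  rw [one_div, Real.log_inv, le_neg]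
  exact (Real.log_le_iff_le_exp (h.delta_pos hε)).2 hexp

theorem sum_touching_singleton_le (h : ExpSlack μ A ε x) (hε : 0 < ε) (S : Finset ι) (k : Fin n) :
    ∑ j ∈ touching A S {k}, x j ≤ 1 + Real.log (1 / delta A x) := by
  classical
  rcases (touching A S {k}).eq_empty_or_nonempty with hempty | ⟨i, hi⟩
  · simpa [hempty] using add_nonneg zero_le_one (h.log_one_div_delta_nonneg hε)
  · have hk : {k} ⊆ vbl (A i) := Set.singleton_subset_iff.2 (mem_touching_singleton.1 hi).2
    calc ∑ j ∈ touching A S {k}, x j ≤ ∑ j ∈ insert i (nbhd A i), x j :=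
          Finset.sum_le_sum_of_subset_of_nonneg
            ((touching_mono subset_rfl hk).trans touching_subset_insert_nbhd)
            fun j _ _ => (h.pos j).le
      _ = x i + ∑ j ∈ nbhd A i, x j :=
          Finset.sum_insert fun hi => (mem_nbhd.1 hi).1 rfl
      _ ≤ 1 + Real.log (1 / delta A x) :=
          add_le_add (by linarith [h.lt i]) (h.sum_nbhd_le hε i)

theorem sum_le_of_vbl_nonempty (h : ExpSlack μ A ε x) (hε : 0 < ε)
    (hS : ∀ i ∈ S, (vbl (A i)).Nonempty) :
    ∑ i ∈ S, x i ≤ n * (1 + Real.log (1 / delta A x)) := by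
  classical
  rcases S.eq_empty_or_nonempty with rfl | ⟨i, hi⟩
  · have hL := h.log_one_div_delta_nonneg hε
    rw [Finset.sum_empty]
    positivity
  have : Nonempty (Fin n) := ⟨(hS i hi).some⟩
  choose! k hk using hS
  calc ∑ i ∈ S, x i = ∑ l, ∑ i ∈ S with k i = l, x i := (Finset.sum_fiberwise S k x).symm
    _ ≤ ∑ l, ∑ i ∈ touching A S {l}, x i := by
        refine Finset.sum_le_sum fun l _ => Finset.sum_le_sum_of_subset_of_nonneg
          (fun i hi => ?_) fun i _ _ => (h.pos i).le
        obtain ⟨hiS, rfl⟩ := Finset.mem_filter.1 hi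
        exact mem_touching_singleton.2 ⟨hiS, hk i hiS⟩
    _ ≤ ∑ _l : Fin n, (1 + Real.log (1 / delta A x)) :=
        Finset.sum_le_sum fun l _ => h.sum_touching_singleton_le hε S l
    _ = n * (1 + Real.log (1 / delta A x)) := by
        rw [Finset.sum_const, Finset.card_fin, nsmul_eq_mul]

theorem prod_one_add_odds (h : ExpSlack μ A ε x) (hε : 0 < ε) (T : Finset ι) :
    ∏ j ∈ T, (1 + odds x j) = ENNReal.ofReal (∏ j ∈ T, (1 - x j))⁻¹ := by
  rw [← Finset.prod_inv_distrib,
    ENNReal.ofReal_prod_of_nonneg fun j _ => (inv_pos.2 (h.one_sub_pos hε j)).le]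
  refine Finset.prod_congr rfl fun j _ => ?_
  have hj := h.one_sub_pos hε j
  rw [odds, ← ENNReal.ofReal_one, ← ENNReal.ofReal_add zero_le_one (div_pos (h.pos j) hj).le]
  congr 1
  field_simp
  ring

theorem ofReal_mul_prod_touching_le (h : ExpSlack μ A ε x) (hε : 0 < ε) {a : ℝ}
    (ha : a ≤ lllBound A x i) (S : Finset ι) :
    ENNReal.ofReal a * ∏ j ∈ touching A S (vbl (A i)), (1 + odds x j) ≤ odds x i := by
  classical
  have hi : i ∉ nbhd A i := fun hi => (mem_nbhd.1 hi).1 rfl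
  have hN := (h.prod_one_sub_pos hε (nbhd A i)).ne'
  calc ENNReal.ofReal a * ∏ j ∈ touching A S (vbl (A i)), (1 + odds x j)
      ≤ ENNReal.ofReal (lllBound A x i) * ∏ j ∈ insert i (nbhd A i), (1 + odds x j) := by
        gcongr ?_ * ?_
        · exact ENNReal.ofReal_le_ofReal ha
        · exact Finset.prod_le_prod_of_subset_of_one_le' touching_subset_insert_nbhd
            fun j _ _ => le_self_add
    _ = odds x i := by
        rw [h.prod_one_add_odds hε, ← ENNReal.ofReal_mul (h.lllBound_pos hε i).le,
          Finset.prod_insert hi, odds, lllBound]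
        congr 1
        field_simp

theorem ofReal_mul_prod_touching_le_of_notMem (h : ExpSlack μ A ε x) (hε : 0 < ε) {a b : ℝ}
    (hab : a ≤ lllBound A x i * b) (hi : i ∉ S) :
    ENNReal.ofReal a * ∏ j ∈ touching A S (vbl (A i)), (1 + odds x j) ≤
      ENNReal.ofReal (x i * b) := by
  have hN := h.prod_one_sub_pos hε (nbhd A i)
  calc ENNReal.ofReal a * ∏ j ∈ touching A S (vbl (A i)), (1 + odds x j)
      ≤ ENNReal.ofReal (lllBound A x i * b) * ∏ j ∈ nbhd A i, (1 + odds x j) := by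
        gcongr ?_ * ?_
        · exact ENNReal.ofReal_le_ofReal hab
        · exact Finset.prod_le_prod_of_subset_of_one_le' (touching_subset_nbhd hi)
            fun j _ _ => le_self_add
    _ = ENNReal.ofReal (x i * b) := by
        rw [h.prod_one_add_odds hε, ← ENNReal.ofReal_mul' (inv_pos.2 hN).le, lllBound]
        congr 1
        field_simp

theorem one_add_sum_odds_le (h : ExpSlack μ A ε x) (hε : 0 < ε) (hε1 : ε < 1) (S : Finset ι)
    (k : Fin n) :
    1 + ∑ j ∈ touching A S {k}, odds x j ≤
      ENNReal.ofReal ((2 + Real.log (1 / delta A x)) / ε) := by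
  have hodds : ∀ j, 0 ≤ x j / (1 - x j) := fun j => (div_pos (h.pos j) (h.one_sub_pos hε j)).le
  simp only [odds]
  rw [← ENNReal.ofReal_sum_of_nonneg fun j _ => hodds j, ← ENNReal.ofReal_one,
    ← ENNReal.ofReal_add zero_le_one (Finset.sum_nonneg fun j _ => hodds j)]
  refine ENNReal.ofReal_le_ofReal ?_
  calc 1 + ∑ j ∈ touching A S {k}, x j / (1 - x j)
      ≤ 1 / ε + ∑ j ∈ touching A S {k}, x j / ε := by
        gcongr with j
        · exact (one_le_div hε).2 hε1.le
        · exact (h.pos j).le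
        · linarith [h.lt j]
    _ = (1 + ∑ j ∈ touching A S {k}, x j) / ε := by rw [← Finset.sum_div, add_div]
    _ ≤ (2 + Real.log (1 / delta A x)) / ε := by
        exact div_le_div_of_nonneg_right (by linarith [h.sum_touching_singleton_le hε S k]) hε.le

theorem prob_le_lllBound_mul_rpow (h : ExpSlack μ A ε x) (hε : 0 < ε) (i : ι) :
    prob μ (A i) ≤ lllBound A x i * prob μ (A i) ^ ε := by
  calc prob μ (A i) = prob μ (A i) ^ (1 - ε) * prob μ (A i) ^ ε := by
        rw [← Real.rpow_add_of_nonneg (prob_nonneg μ _) (by linarith [h.eps_lt_one i]) hε.le]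
        simp
    _ ≤ lllBound A x i * prob μ (A i) ^ ε :=
        mul_le_mul_of_nonneg_right (h.bound i) (Real.rpow_nonneg (prob_nonneg μ _) _)

variable [∀ k, IsProbabilityMeasure (μ k)]

theorem prob_le_lllBound (h : ExpSlack μ A ε x) (hε : 0 < ε) (i : ι) :
    prob μ (A i) ≤ lllBound A x i :=
  (h.prob_le_lllBound_mul_rpow hε i).trans (mul_le_of_le_one_right (h.lllBound_pos hε i).le
    (Real.rpow_le_one (prob_nonneg μ _) measureReal_le_one hε.le))

theorem exp_mul_prob_le_lllBound (h : ExpSlack μ A ε x) (hε : 0 < ε) (i : ι) :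
    Real.exp (ε ^ 2) * prob μ (A i) ≤ lllBound A x i := by
  have hexp : prob μ (A i) ≤ Real.exp (-ε) := by
    linarith [h.prob_le_lllBound hε i, h.lllBound_le hε i, h.lt i, Real.one_sub_le_exp_neg ε]
  have hpow : prob μ (A i) ^ ε ≤ Real.exp (-ε ^ 2) := by
    calc prob μ (A i) ^ ε ≤ Real.exp (-ε) ^ ε :=
          Real.rpow_le_rpow (prob_nonneg μ _) hexp hε.le
      _ = Real.exp (-ε ^ 2) := by rw [← Real.exp_mul]; ring_nf
  calc Real.exp (ε ^ 2) * prob μ (A i)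
      ≤ Real.exp (ε ^ 2) * (lllBound A x i * Real.exp (-ε ^ 2)) := by
        gcongr
        exact (h.prob_le_lllBound_mul_rpow hε i).trans
          (mul_le_mul_of_nonneg_left hpow (h.lllBound_pos hε i).le)
    _ = lllBound A x i := by
        rw [mul_left_comm, ← Real.exp_add, add_neg_cancel, Real.exp_zero, mul_one]

theorem vbl_nonempty (h : ExpSlack μ A ε x) (hε : 0 < ε) (hi : (A i).Nonempty) :
    (vbl (A i)).Nonempty := by
  by_contra hempty
  rcases eq_empty_or_univ_of_vbl_eq_empty (Set.not_nonempty_iff_eq_empty.1 hempty) with hA | hA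
  · exact hi.ne_empty hA
  · have hprob : prob μ (A i) = 1 := by simp [prob, hA]
    linarith [h.prob_le_lllBound hε i, h.lllBound_le hε i, h.lt i]

theorem vbl_nonempty_of_mem_core (h : ExpSlack μ A ε x) (hε : 0 < ε) (hp : 0 < p)
    (hi : i ∈ core μ A p) : (vbl (A i)).Nonempty :=
  h.vbl_nonempty hε (nonempty_of_measureReal_ne_zero (hp.trans_le (mem_core.1 hi)).ne')

theorem card_core_mul_le (h : ExpSlack μ A ε x) (hε : 0 < ε) (hp : 0 < p) :
    (core μ A p).card * p ≤ n * (1 + Real.log (1 / delta A x)) := by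
  calc (core μ A p).card * p = ∑ _i ∈ core μ A p, p := by simp
    _ ≤ ∑ i ∈ core μ A p, x i := Finset.sum_le_sum fun i hi =>
        (mem_core.1 hi).trans ((h.prob_le_lllBound hε i).trans (h.lllBound_le hε i))
    _ ≤ n * (1 + Real.log (1 / delta A x)) :=
        h.sum_le_of_vbl_nonempty hε fun _ hi => h.vbl_nonempty_of_mem_core hε hp hi

theorem card_core_le (h : ExpSlack μ A ε x) (hε : 0 < ε) {s : ℝ} (hs : 0 < s) (hp : 1 / s ≤ p) :
    (core μ A p).card ≤ s * (n * (1 + Real.log (1 / delta A x))) := by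
  have hp0 : 0 < p := (one_div_pos.2 hs).trans_le hp
  rw [← div_le_iff₀' hs, ← mul_one_div]
  exact (mul_le_mul_of_nonneg_left hp (Nat.cast_nonneg _)).trans (h.card_core_mul_le hε hp0)

theorem real_moserTardos_mem_le (h : ExpSlack μ A ε x) (hε : 0 < ε)
    (hA : ∀ i, MeasurableSet (A i)) (hp : 0 < p) (V : Verifier A (core μ A p)) (K : ℕ)
    (hi : i ∉ core μ A p) :
    (sampleLaw μ).real {ξ | (moserTardos V K ξ).result ∈ some '' A i} ≤ x i * p ^ ε := by
  have hprob : prob μ (A i) ≤ lllBound A x i * p ^ ε := by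
    have hlt : prob μ (A i) < p := lt_of_not_ge (mt mem_core.2 hi)
    refine (h.prob_le_lllBound_mul_rpow hε i).trans ?_
    exact mul_le_mul_of_nonneg_left (Real.rpow_le_rpow (prob_nonneg μ _) hlt.le hε.le)
      (h.lllBound_pos hε i).le
  have hy : ∀ j ∈ core μ A p, Measure.pi μ (A j) *
      ∏ l ∈ touching A (core μ A p) (vbl (A j)), (1 + odds x l) ≤ odds x j := fun j _ => by
    rw [← ofReal_measureReal]
    exact h.ofReal_mul_prod_touching_le hε (h.prob_le_lllBound hε j) _
  refine ENNReal.toReal_le_of_le_ofReal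
    (mul_nonneg (h.pos i).le (Real.rpow_nonneg hp.le _)) ?_
  refine (sampleLaw_moserTardos_mem_le V hA (fun j hj => h.vbl_nonempty_of_mem_core hε hp hj)
    hy (hA i) K).trans ?_
  rw [← ofReal_measureReal]
  exact h.ofReal_mul_prod_touching_le_of_notMem hε hprob hi

theorem real_moserTardos_none_le (h : ExpSlack μ A ε x) (hε : 0 < ε) (hε1 : ε < 1)
    (hA : ∀ i, MeasurableSet (A i)) (hn : 0 < n) (hp : 0 < p) (V : Verifier A (core μ A p))
    {m K : ℕ} (hm : n * m ≤ K) :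
    (sampleLaw μ).real {ξ | (moserTardos V K ξ).result = none} ≤
      Real.exp (-(m * ε ^ 2)) * (n * ((2 + Real.log (1 / delta A x)) / ε)) := by
  have hL := h.log_one_div_delta_nonneg hε
  have hlam : 1 ≤ ENNReal.ofReal (Real.exp (ε ^ 2)) :=
    ENNReal.one_le_ofReal.2 (Real.one_le_exp (sq_nonneg ε))
  have hy : ∀ j ∈ core μ A p, ENNReal.ofReal (Real.exp (ε ^ 2)) * Measure.pi μ (A j) *
      ∏ l ∈ touching A (core μ A p) (vbl (A j)), (1 + odds x l) ≤ odds x j := fun j _ => by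
    rw [← ofReal_measureReal, ← ENNReal.ofReal_mul (Real.exp_pos _).le]
    exact h.ofReal_mul_prod_touching_le hε (h.exp_mul_prob_le_lllBound hε j) _
  refine ENNReal.toReal_le_of_le_ofReal (by positivity) ?_
  calc sampleLaw μ {ξ | (moserTardos V K ξ).result = none}
      ≤ (ENNReal.ofReal (Real.exp (ε ^ 2)) ^ m)⁻¹ *
          ∑ k, (1 + ∑ j ∈ touching A (core μ A p) {k}, odds x j) :=
        sampleLaw_moserTardos_none_le V hA hn
          (fun j hj => h.vbl_nonempty_of_mem_core hε hp hj) hlam ENNReal.ofReal_ne_top hy hm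
    _ ≤ (ENNReal.ofReal (Real.exp (ε ^ 2)) ^ m)⁻¹ *
          ∑ _k : Fin n, ENNReal.ofReal ((2 + Real.log (1 / delta A x)) / ε) := by
        gcongr with k
        exact h.one_add_sum_odds_le hε hε1 _ k
    _ = ENNReal.ofReal
          (Real.exp (-(m * ε ^ 2)) * (n * ((2 + Real.log (1 / delta A x)) / ε))) := by
        rw [← ENNReal.ofReal_pow (Real.exp_pos _).le, ← Real.exp_nat_mul,
          ← ENNReal.ofReal_inv_of_pos (Real.exp_pos _), ← Real.exp_neg, Finset.sum_const,
          Finset.card_fin, nsmul_eq_mul, ← ENNReal.ofReal_natCast,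
          ← ENNReal.ofReal_mul (Nat.cast_nonneg n), ← ENNReal.ofReal_mul (Real.exp_pos _).le]

end ExpSlack

end ExpSlack

section Parameters

theorem exists_eval_le_pow (q : Polynomial ℕ) : ∃ d : ℕ, ∀ n : ℕ, 2 ≤ n → q.eval n ≤ n ^ d := by
  refine ⟨q.eval 1 + q.natDegree, fun n hn => ?_⟩
  calc q.eval n ≤ q.eval 1 * n ^ q.natDegree := by
        rw [Polynomial.eval_eq_sum_range, Polynomial.eval_eq_sum_range, Finset.sum_mul]
        refine Finset.sum_le_sum fun i hi => ?_
        rw [one_pow, mul_one]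
        exact Nat.mul_le_mul_left _ (Nat.pow_le_pow_right (by lia)
          (Nat.lt_succ_iff.1 (Finset.mem_range.1 hi)))
    _ ≤ n ^ q.eval 1 * n ^ q.natDegree := Nat.mul_le_mul_right _ (Nat.lt_pow_self hn).le
    _ = n ^ (q.eval 1 + q.natDegree) := (pow_add _ _ _).symm

theorem exists_eval_mul_rpow_le (q : Polynomial ℕ) (c : ℝ) :
    ∃ C : ℝ, 1 ≤ C ∧ ∀ n : ℕ, 2 ≤ n → (q.eval n : ℕ) * (n : ℝ) ^ (-C) ≤ (n : ℝ) ^ (-c) := by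
  obtain ⟨d, hd⟩ := exists_eval_le_pow q
  refine ⟨max 1 (c + d), le_max_left _ _, fun n hn => ?_⟩
  have hn1 : (1 : ℝ) ≤ n := by exact_mod_cast one_le_two.trans hn
  have hexp : -max 1 (c + d) ≤ -(c + d) := neg_le_neg (le_max_right _ _)
  calc (q.eval n : ℕ) * (n : ℝ) ^ (-max 1 (c + d)) ≤ (n : ℝ) ^ (d : ℝ) * (n : ℝ) ^ (-(c + d)) := by
        rw [Real.rpow_natCast]
        gcongr
        exact_mod_cast hd n hn
    _ = (n : ℝ) ^ (-c) := by
        rw [← Real.rpow_add (zero_lt_one.trans_le hn1)]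
        congr 1
        ring

variable {C ε : ℝ}

theorem resamplingBound_nonneg (hC : 0 ≤ C) (hn : 0 < n) (hε : 0 < ε) (hε1 : ε < 1) :
    0 ≤ resamplingBound C n ε := by
  have hn1 : (1 : ℝ) ≤ n := by exact_mod_cast hn
  have hratio : 1 ≤ (n : ℝ) / ε ^ 2 :=
    (one_le_div (by positivity)).2 ((pow_le_one₀ hε.le hε1.le).trans hn1)
  exact mul_nonneg (by positivity) (Real.log_nonneg hratio)

theorem mul_log_div_le_floor (hn : 0 < n) (hε : 0 < ε) :
    C * Real.log ((n : ℝ) / ε ^ 2) ≤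
      ((⌊resamplingBound C n ε⌋₊ / n : ℕ) + 1) * ε ^ 2 := by
  have hn0 : (0 : ℝ) < n := by exact_mod_cast hn
  have hfloor : resamplingBound C n ε ≤ n * ((⌊resamplingBound C n ε⌋₊ / n : ℕ) + 1) := by
    refine (Nat.lt_floor_add_one _).le.trans ?_
    exact_mod_cast Nat.succ_le_of_lt (Nat.lt_mul_div_succ ⌊resamplingBound C n ε⌋₊ hn)
  have hbound : resamplingBound C n ε = n * (C * Real.log ((n : ℝ) / ε ^ 2) / ε ^ 2) := by
    rw [resamplingBound]
    ring
  exact (div_le_iff₀ (by positivity)).1 (le_of_mul_le_mul_left (hbound ▸ hfloor) hn0)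

theorem exp_neg_floor_div_le (hC : 1 ≤ C) (hn : 0 < n) (hε : 0 < ε) (hε1 : ε < 1) :
    Real.exp (-((⌊resamplingBound C n ε⌋₊ / n : ℕ) * ε ^ 2)) / ε ≤ 8 * (n : ℝ) ^ (-C) := by
  have hn0 : (0 : ℝ) < n := by exact_mod_cast hn
  have hlogε : Real.log ε ≤ 0 := Real.log_nonpos hε.le hε1.le
  have hlog : Real.log ((n : ℝ) / ε ^ 2) = Real.log n - 2 * Real.log ε := by
    rw [Real.log_div hn0.ne' (by positivity), Real.log_pow]
    norm_cast
  have hexp : -((⌊resamplingBound C n ε⌋₊ / n : ℕ) * ε ^ 2) - Real.log ε ≤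
      1 + Real.log n * -C := by
    have hfloor := mul_log_div_le_floor (C := C) hn hε
    rw [hlog] at hfloor
    nlinarith [pow_le_one₀ (n := 2) hε.le hε1.le]
  calc Real.exp (-((⌊resamplingBound C n ε⌋₊ / n : ℕ) * ε ^ 2)) / ε
      = Real.exp (-((⌊resamplingBound C n ε⌋₊ / n : ℕ) * ε ^ 2) - Real.log ε) := by
        rw [Real.exp_sub, Real.exp_log hε]
    _ ≤ Real.exp 1 * Real.exp (Real.log n * -C) :=
        (Real.exp_le_exp.2 hexp).trans_eq (Real.exp_add _ _)
    _ ≤ 8 * (n : ℝ) ^ (-C) := by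
        rw [Real.rpow_def_of_pos hn0]
        gcongr
        linarith [Real.exp_one_lt_d9]

end Parameters

section Guarantee

variable [∀ k, MeasurableSpace (Ω k)] {A : ι → Set (∀ k, Ω k)} {S : Finset ι}

theorem resamplings_moserTardos_le (V : Verifier A S) {R : ℝ} (hR : 0 ≤ R) (ξ : ℕ → ∀ k, Ω k) :
    ((moserTardos V ⌊R⌋₊ ξ).resamplings : ℝ) ≤ R :=
  (Nat.cast_le.2 (resamplings_mtLoop_le V ξ ⌊R⌋₊ 1 (ξ 0))).trans (Nat.floor_le hR)

theorem steps_moserTardos_le (V : Verifier A S) {τ : ℕ} (hτ : ∀ ω, V.cost ω ≤ τ) {R : ℝ}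
    (hR : 0 ≤ R) (ξ : ℕ → ∀ k, Ω k) :
    ((moserTardos V ⌊R⌋₊ ξ).steps : ℝ) ≤ (R + 1) * ((n : ℝ) + τ) := by
  have hsteps : (moserTardos V ⌊R⌋₊ ξ).steps ≤ (⌊R⌋₊ + 1) * (n + τ) := by
    have hloop := steps_mtLoop_le V hτ ξ ⌊R⌋₊ 1 (ξ 0)
    simp only [moserTardos]
    linarith
  calc ((moserTardos V ⌊R⌋₊ ξ).steps : ℝ) ≤ (⌊R⌋₊ + 1) * ((n : ℝ) + τ) := by
        exact_mod_cast hsteps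
    _ ≤ (R + 1) * ((n : ℝ) + τ) := by
        gcongr
        exact Nat.floor_le hR

variable [Fintype ι] {μ : ∀ k, Measure (Ω k)} [∀ k, IsProbabilityMeasure (μ k)]

theorem one_le_real_good_add [DecidableEq ι] (V : Verifier A S) (K : ℕ) :
    1 ≤ (sampleLaw μ).real {ξ | ∃ ω, (moserTardos V K ξ).result = some ω ∧ Good A ω} +
      ((sampleLaw μ).real {ξ | (moserTardos V K ξ).result = none} +
        ∑ i ∈ Sᶜ, (sampleLaw μ).real {ξ | (moserTardos V K ξ).result ∈ some '' A i}) := by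
  have hcover : (Set.univ : Set (ℕ → ∀ k, Ω k)) ⊆
      {ξ | ∃ ω, (moserTardos V K ξ).result = some ω ∧ Good A ω} ∪
        ({ξ | (moserTardos V K ξ).result = none} ∪
          ⋃ i ∈ Sᶜ, {ξ | (moserTardos V K ξ).result ∈ some '' A i}) := by
    intro ξ _
    cases hr : (moserTardos V K ξ).result with
    | none => exact Or.inr (Or.inl hr)
    | some ω =>
      by_cases hgood : Good A ω
      · exact Or.inl ⟨ω, hr, hgood⟩
      · obtain ⟨i, hi⟩ : ∃ i, ω ∈ A i := by simpa [Good] using hgood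
        have hiS : i ∈ Sᶜ := Finset.mem_compl.2 fun hiS => notMem_of_result_mtLoop V hr i hiS hi
        exact Or.inr (Or.inr (Set.mem_biUnion (Finset.mem_coe.2 hiS) ⟨ω, hi, hr.symm⟩))
  calc (1 : ℝ) = (sampleLaw μ).real Set.univ := probReal_univ.symm
    _ ≤ _ := measureReal_mono hcover
    _ ≤ _ := measureReal_union_le _ _
    _ ≤ _ := by
        gcongr
        refine (measureReal_union_le _ _).trans ?_
        gcongr
        exact measureReal_biUnion_finset_le _ _

namespace ExpSlack

variable {ε p C : ℝ} {x : ι → ℝ}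

theorem real_moserTardos_none_le_rpow (h : ExpSlack μ A ε x) (hε : 0 < ε) (hε1 : ε < 1)
    (hA : ∀ i, MeasurableSet (A i)) (hn : 0 < n) (hp : 0 < p) (V : Verifier A (core μ A p))
    (hC : 1 ≤ C) :
    (sampleLaw μ).real {ξ | (moserTardos V ⌊resamplingBound C n ε⌋₊ ξ).result = none} ≤
      8 * (n * (2 + Real.log (1 / delta A x))) * (n : ℝ) ^ (-C) := by
  have hL := h.log_one_div_delta_nonneg hε
  set m := ⌊resamplingBound C n ε⌋₊ / n
  calc (sampleLaw μ).real {ξ | (moserTardos V ⌊resamplingBound C n ε⌋₊ ξ).result = none}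
      ≤ Real.exp (-(m * ε ^ 2)) * (n * ((2 + Real.log (1 / delta A x)) / ε)) :=
        h.real_moserTardos_none_le hε hε1 hA hn hp V (Nat.mul_div_le _ n)
    _ = n * (2 + Real.log (1 / delta A x)) * (Real.exp (-(m * ε ^ 2)) / ε) := by ring
    _ ≤ n * (2 + Real.log (1 / delta A x)) * (8 * (n : ℝ) ^ (-C)) := by
        gcongr
        exact exp_neg_floor_div_le hC hn hε hε1
    _ = 8 * (n * (2 + Real.log (1 / delta A x))) * (n : ℝ) ^ (-C) := by ring

theorem sum_real_moserTardos_mem_le [DecidableEq ι] (h : ExpSlack μ A ε x) (hε : 0 < ε)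
    (hA : ∀ i, MeasurableSet (A i)) (hp : 0 < p) (V : Verifier A (core μ A p)) (K : ℕ) :
    ∑ i ∈ (core μ A p)ᶜ, (sampleLaw μ).real {ξ | (moserTardos V K ξ).result ∈ some '' A i} ≤
      n * (1 + Real.log (1 / delta A x)) * p ^ ε := by
  classical
  calc ∑ i ∈ (core μ A p)ᶜ, (sampleLaw μ).real {ξ | (moserTardos V K ξ).result ∈ some '' A i}
      ≤ ∑ i ∈ (core μ A p)ᶜ, if (A i).Nonempty then x i * p ^ ε else 0 := by
        refine Finset.sum_le_sum fun i hi => ?_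
        split_ifs with hne
        · exact h.real_moserTardos_mem_le hε hA hp V K (Finset.mem_compl.1 hi)
        · simp [Set.not_nonempty_iff_eq_empty.1 hne]
    _ = (∑ i ∈ (core μ A p)ᶜ with (A i).Nonempty, x i) * p ^ ε := by
        rw [← Finset.sum_filter, Finset.sum_mul]
    _ ≤ n * (1 + Real.log (1 / delta A x)) * p ^ ε := by
        gcongr
        exact h.sum_le_of_vbl_nonempty hε fun i hi => h.vbl_nonempty hε (Finset.mem_filter.1 hi).2

theorem one_sub_le_real_good (h : ExpSlack μ A ε x) (hε : 0 < ε) (hε1 : ε < 1)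
    (hA : ∀ i, MeasurableSet (A i)) (hn : 0 < n) (hp : 0 < p) (hpn : p ≤ (n : ℝ) ^ (-(C / ε)))
    (V : Verifier A (core μ A p)) (hC : 1 ≤ C) :
    1 - 9 * (n * (2 + Real.log (1 / delta A x))) * (n : ℝ) ^ (-C) ≤
      (sampleLaw μ).real {ξ | ∃ ω,
        (moserTardos V ⌊resamplingBound C n ε⌋₊ ξ).result = some ω ∧ Good A ω} := by
  classical
  have hL := h.log_one_div_delta_nonneg hε
  have hpε : p ^ ε ≤ (n : ℝ) ^ (-C) := by
    refine (Real.rpow_le_rpow hp.le hpn hε.le).trans_eq ?_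
    rw [← Real.rpow_mul (Nat.cast_nonneg n), neg_mul, div_mul_cancel₀ C hε.ne']
  have hbad : n * (1 + Real.log (1 / delta A x)) * p ^ ε ≤
      n * (2 + Real.log (1 / delta A x)) * (n : ℝ) ^ (-C) := by
    gcongr
    exact one_le_two
  linarith [one_le_real_good_add (μ := μ) V ⌊resamplingBound C n ε⌋₊,
    h.real_moserTardos_none_le_rpow hε hε1 hA hn hp V hC,
    h.sum_real_moserTardos_mem_le hε hA hp V ⌊resamplingBound C n ε⌋₊]

end ExpSlack

end Guarantee

end LLL

theorem theorem3p4 (q : Polynomial ℕ) (c : ℝ) (hc : 0 < c) :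
    ∃ C D : ℝ, 0 < C ∧ 0 < D ∧ ∀ s : Polynomial ℕ, ∃ r : Polynomial ℕ,
      ∀ (n : ℕ) (_ : 0 < n) (Ω : Fin n → Type*) [∀ k, MeasurableSpace (Ω k)]
        (μ : ∀ k, Measure (Ω k)) [∀ k, IsProbabilityMeasure (μ k)]
        (ι : Type*) [Fintype ι] (A : ι → Set (∀ k, Ω k)) (_ : ∀ i, MeasurableSet (A i))
        (ε : ℝ) (_ : 0 < ε) (_ : ε < 1) (x : ι → ℝ) (_ : LLL.ExpSlack μ A ε x)
        (_ : Real.log (1 / LLL.delta A x) ≤ (q.eval n : ℕ)),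
        -- there are only polynomially many events of probability at least `1 / s(n)`
        (∀ p : ℝ, 0 < s.eval n → 1 / ((s.eval n : ℕ) : ℝ) ≤ p →
          (LLL.core μ A p).card ≤ r.eval n) ∧
        -- the truncated algorithm on the core at any threshold up to `n ^ (- D / ε)`
        (∀ p : ℝ, 0 < p → p ≤ (n : ℝ) ^ (-(D / ε)) →
          ∀ (V : LLL.Verifier A (LLL.core μ A p)) (τ : ℕ) (_ : ∀ ω, V.cost ω ≤ τ) (K : ℕ)
            (_ : K = ⌊LLL.resamplingBound C n ε⌋₊),
            (∀ ξ : ℕ → ∀ k, Ω k,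
              ((LLL.moserTardos V K ξ).resamplings : ℝ) ≤ LLL.resamplingBound C n ε ∧
              ((LLL.moserTardos V K ξ).steps : ℝ) ≤
                (LLL.resamplingBound C n ε + 1) * ((n : ℝ) + (τ : ℝ))) ∧
            1 - (n : ℝ) ^ (-c) ≤
              (LLL.sampleLaw μ).real
                {ξ | ∃ ω, (LLL.moserTardos V K ξ).result = some ω ∧ LLL.Good A ω}) := by
  obtain ⟨C, hC, hqC⟩ := LLL.exists_eval_mul_rpow_le (9 * (Polynomial.X * (2 + q))) c
  have hC0 : 0 < C := zero_lt_one.trans_le hC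
  refine ⟨C, C, hC0, hC0, fun s => ⟨s * (Polynomial.X * (1 + q)), ?_⟩⟩
  intro n hn Ω _ μ _ ι _ A hA ε hε hε1 x h hδ
  refine ⟨fun p hs hp => ?_, fun p hp hpn V τ hτ K hK => ?_⟩
  · have hcard : ((LLL.core μ A p).card : ℝ) ≤ s.eval n * (n * (1 + (q.eval n : ℕ))) :=
      (h.card_core_le hε (by exact_mod_cast hs) hp).trans (by gcongr)
    simp only [Polynomial.eval_mul, Polynomial.eval_X, Polynomial.eval_add, Polynomial.eval_one]
    exact_mod_cast hcard
  subst hK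
  have hR := LLL.resamplingBound_nonneg hC0.le hn hε hε1
  refine ⟨fun ξ => ⟨LLL.resamplings_moserTardos_le V hR ξ, LLL.steps_moserTardos_le V hτ hR ξ⟩, ?_⟩
  rcases (Nat.succ_le_of_lt hn).eq_or_lt with rfl | hn2
  · simp
  refine le_trans (sub_le_sub_left (le_trans ?_ (hqC n hn2)) 1)
    (h.one_sub_le_real_good hε hε1 hA hn hp hpn V hC)
  simp only [Polynomial.eval_mul, Polynomial.eval_X, Polynomial.eval_add, Polynomial.eval_ofNat]
  push_cast
  gcongr
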